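/- **Setting.** Terms are generated by $M ::= x \mid \lambda x.M \mid MM \mid M\oplus M \mid \Omega$. For finite sets $\Gamma$ of variables, the judgement $\Gamma\vdash M$ ("$M$ is affine in $\Gamma$") is given by: $\Gamma,x\vdash x$; $\Gamma\vdash\Omega$; $\Gamma\vdash\lambda x.M$ if $\Gamma,x\vdash M$; $\Gamma,\Delta\vdash MN$ if $\Gamma\vdash M$ and $\Delta\vdash N$ with $\Gamma,\Delta$ disjoint; $\Gamma\vdash M\oplus N$ if $\Gamma\vdash M$ and $\Gamma\vdash N$. Programs are the terms with $\emptyset\vdash M$; values are the programs of the form $\lambda x.M$. The call-by-value semantics assigns to each program $M$ a unique finite value subdistribution $[\![M]\!]$, determined by $[\![\Omega]\!]=\emptyset$, $[\![V]\!]=\{V^1\}$ for values $V$, $[\![M\oplus N]\!]=\tfrac12[\![M]\!]+\tfrac12[\![N]\!]$ and $[\![MN]\!]=\sum_{\lambda x.L,\,V}[\![M]\!](\lambda x.L)\,[\![N]\!](V)\,[\![L\{V/x\}]\!]$. A pseudometric on a set $S$ is a map $\mu:S\times S\to[0,1]$ that vanishes on the diagonal, is symmetric and satisfies the triangle inequality;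 pseudometrics are ordered by $\mu\le\rho$ iff $\rho(s,t)\le\mu(s,t)$ for all $s,t$, and form a complete lattice. The lifting of $\mu$ to finite subdistributions is $$\mu(\mathscr D,\mathscr E)=\min\Big\{\sum_{s,t}h_{s,t}\,\mu(s,t)+\sum_s w_s+\sum_t z_t\ :\ \sum_s h_{s,t}+z_t=\mathscr E(t),\ \sum_t h_{s,t}+w_s=\mathscr D(s),\ h,w,z\ge0\Big\}.$$ Consider the labelled Markov chain whose states are the programs $M$ together with a distinguished copy $\widehat V$ of each value $V$, whose labels are $\mathrm{eval}$ and $@V$ for each value $V$, and whose transitions are $\mathscr P(M,\mathrm{eval})(\widehat V)=[\![M]\!](V)$ and $\mathscr P(\widehat{\lambda x.M},@V)=\{(M\{V/x\})^1\}$, all other transition distributions being empty. Let $F$ be the monotone operator on pseudometrics over the states given by $F(\mu)(s,t)=\sup_a\mu(\mathscr P(s,a),\mathscr P(t,a))$, the supremum being over all labels $a$. Let $\delta$ be the supremum, in the lattice of pseudometrics, of all $\mu$ with $\mu\le F(\mu)$, and let $\delta^{\mathrm b}$ be the restriction of $\delta$ to programs. Contexts are generated by $C ::= [\cdot]\mid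 M\mid\lambda x.C\mid CM\mid MC\mid C\oplus C$; the judgement $\Gamma\vdash C$ is defined by the same rules as for terms, with the additional axiom $\Gamma\vdash[\cdot]$. A context is closed and affine if $\emptyset\vdash C$; then $C[M]$, obtained by putting the program $M$ for the hole, is a program. **Theorem.** The pseudometric $\delta$ is the greatest fixpoint of $F$ (for the order $\le$), and the bisimulation distance $\delta^{\mathrm b}$ is non-expansive: for all programs $M,N$ and every closed affine context $C$, $$\delta^{\mathrm b}(C[M],C[N])\le\delta^{\mathrm b}(M,N).$$ -/

import Mathlib

namespace AffineProb

/-! ### Terms and the affine typing judgement -/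

/-- Terms of the untyped probabilistic lambda-calculus; variables are named by natural numbers. -/
inductive Term : Type
  | var (x : ℕ) : Term
  | lam (x : ℕ) (M : Term) : Term
  | app (M N : Term) : Term
  | choice (M N : Term) : Term
  | omega : Term
deriving DecidableEq, Countable

/-- `Affine Γ M` is the judgement `Γ ⊢ M`. In the rule for abstractions `x` may shadow a variable
of `Γ`, so that a term is derivable as soon as one of its renamings with fresh bound names is. -/
inductive Affine : Finset ℕ → Term → Prop
  | var {Γ : Finset ℕ} {x : ℕ} (hx : x ∈ Γ) : Affine Γ (Term.var x)
  | lam {Γ : Finset ℕ} {x : ℕ} {M : Term} (hM : Affine (insert x Γ) M) : Affine Γ (Term.lam x M)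
  | app {Γ Δ : Finset ℕ} {M N : Term} (hd : Disjoint Γ Δ) (hM : Affine Γ M) (hN : Affine Δ N) :
      Affine (Γ ∪ Δ) (Term.app M N)
  | choice {Γ : Finset ℕ} {M N : Term} (hM : Affine Γ M) (hN : Affine Γ N) :
      Affine Γ (Term.choice M N)
  | omega {Γ : Finset ℕ} : Affine Γ Term.omega

/-- `M.subst x V` is `M{V/x}`. It is only used with `V` closed, so no capture can occur. -/
def Term.subst : Term → ℕ → Term → Term
  | .var y, x, V => if y = x then V else .var y
  | .lam y M, x, V => if y = x then .lam y M else .lam y (M.subst x V)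
  | .app M N, x, V => .app (M.subst x V) (N.subst x V)
  | .choice M N, x, V => .choice (M.subst x V) (N.subst x V)
  | .omega, _, _ => .omega

theorem Affine.weaken {Γ : Finset ℕ} {M : Term} (h : Affine Γ M) :
    ∀ {Δ : Finset ℕ}, Γ ⊆ Δ → Affine Δ M := by
  induction h with
  | var hx => intro Δ hs; exact .var (hs hx)
  | lam _ ih => intro Δ hs; exact .lam (ih (Finset.insert_subset_insert _ hs))
  | @app Γ₁ Γ₂ M N hd _ _ ih₁ ih₂ =>
    intro Δ hs
    have h1 : Γ₁ ⊆ Δ := Finset.union_subset_left hs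
    have h2 : Γ₂ ⊆ Δ \ Γ₁ := fun z hz => Finset.mem_sdiff.2
      ⟨hs (Finset.mem_union_right _ hz), fun hz' => (Finset.disjoint_left.1 hd hz') hz⟩
    have := Affine.app (Finset.disjoint_sdiff) (ih₁ (Finset.Subset.refl Γ₁)) (ih₂ h2)
    rwa [Finset.union_sdiff_of_subset h1] at this
  | choice _ _ ih₁ ih₂ => intro Δ hs; exact .choice (ih₁ hs) (ih₂ hs)
  | omega => intro Δ _; exact .omega

theorem Affine.var_inv {Γ : Finset ℕ} {x : ℕ} (h : Affine Γ (.var x)) : x ∈ Γ := by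
  generalize hT : Term.var x = T at h
  cases h with
  | var hx => cases hT; exact hx
  | _ => cases hT

theorem Affine.lam_inv {Γ : Finset ℕ} {x : ℕ} {M : Term} (h : Affine Γ (.lam x M)) :
    Affine (insert x Γ) M := by
  generalize hT : Term.lam x M = T at h
  cases h with
  | lam hM => cases hT; exact hM
  | _ => cases hT

theorem Affine.choice_inv {Γ : Finset ℕ} {M N : Term} (h : Affine Γ (.choice M N)) :
    Affine Γ M ∧ Affine Γ N := by
  generalize hT : Term.choice M N = T at h
  cases h with
  | choice hM hN => cases hT; exact ⟨hM, hN⟩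
  | _ => cases hT

theorem Affine.app_inv {Γ : Finset ℕ} {M N : Term} (h : Affine Γ (.app M N)) :
    Affine Γ M ∧ Affine Γ N := by
  generalize hT : Term.app M N = T at h
  cases h with
  | app hd hM hN =>
    cases hT
    exact ⟨hM.weaken Finset.subset_union_left, hN.weaken Finset.subset_union_right⟩
  | _ => cases hT

theorem Affine.subst {Γ : Finset ℕ} {M V : Term} (x : ℕ) (h : Affine Γ M) (hV : Affine ∅ V) :
    Affine (Γ.erase x) (M.subst x V) := by
  induction h with
  | @var Γ y hy =>
    simp only [Term.subst]
    split_ifs with hyx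
    · exact hV.weaken (Finset.empty_subset _)
    · exact .var (Finset.mem_erase.2 ⟨hyx, hy⟩)
  | @lam Γ y M hM ih =>
    simp only [Term.subst]
    split_ifs with hyx
    · subst hyx
      refine .lam (hM.weaken ?_)
      intro z; simp only [Finset.mem_insert, Finset.mem_erase]; tauto
    · refine .lam (ih.weaken ?_)
      intro z; simp only [Finset.mem_insert, Finset.mem_erase]; tauto
  | app hd _ _ ih₁ ih₂ =>
    simp only [Term.subst]
    rw [Finset.erase_union_distrib]
    exact .app (hd.mono (Finset.erase_subset _ _) (Finset.erase_subset _ _)) ih₁ ih₂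
  | choice _ _ ih₁ ih₂ => exact .choice ih₁ ih₂
  | omega => exact .omega

/-- Programs are the closed affine terms. -/
def Program : Type := {M : Term // Affine ∅ M}

instance : Countable Program := inferInstanceAs (Countable {M : Term // Affine ∅ M})

/-- A value is a program of the form `λx.M`. -/
@[ext]
structure Value : Type where
  x : ℕ
  body : Term
  affine : Affine {x} body

/-- The term `λx.M` underlying a value. -/
def Value.toTerm (V : Value) : Term := .lam V.x V.body

theorem Value.affine_toTerm (V : Value) : Affine ∅ V.toTerm := .lam V.affine

def Value.toProgram (V : Value) : Program := ⟨V.toTerm, V.affine_toTerm⟩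

instance : Countable Value :=
  Function.Injective.countable (f := fun V : Value => (V.x, V.body)) (by
    rintro ⟨x, M, h⟩ ⟨y, N, h'⟩ he
    simp only [Prod.mk.injEq] at he
    obtain ⟨rfl, rfl⟩ := he
    rfl)

theorem Value.affine_beta (W V : Value) : Affine ∅ (W.body.subst W.x V.toTerm) :=
  (W.affine.subst W.x V.affine_toTerm).weaken (by simp)

/-- `W.beta V` is the program `M{V/x}` if `W` is `λx.M`. -/
def Value.beta (W V : Value) : Program := ⟨W.body.subst W.x V.toTerm, W.affine_beta V⟩

/-! ### Finite subdistributions and the big-step semantics -/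

/-- Finite (sub)distributions on `S`. -/
structure FinDistr (S : Type) : Type where
  toFinsupp : S →₀ ℝ
  nonneg : ∀ s, 0 ≤ toFinsupp s
  sum_le_one : (toFinsupp.sum fun _ p => p) ≤ 1

namespace FinDistr

/-- The empty distribution. -/
def empty (S : Type) : FinDistr S := ⟨0, by simp, by simp⟩

/-- The Dirac distribution. -/
noncomputable def dirac {S : Type} (s : S) : FinDistr S :=
  ⟨Finsupp.single s 1, fun t => by classical rw [Finsupp.single_apply]; split_ifs <;> simp,
    by simp⟩

/-- The image of a distribution under an injection. -/
noncomputable def map {S T : Type} (f : S ↪ T) (D : FinDistr S) : FinDistr T :=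
  ⟨D.toFinsupp.embDomain f, fun t => by
    by_cases h : t ∈ Set.range f
    · obtain ⟨s, rfl⟩ := h
      rw [Finsupp.embDomain_apply_self]; exact D.nonneg s
    · rw [Finsupp.embDomain_of_notMem_range _ _ _ h], by
    have := D.sum_le_one
    simpa [Finsupp.sum, Finsupp.support_embDomain, Finset.sum_map,
      Finsupp.embDomain_apply_self] using this⟩

end FinDistr

/-- `BigStep M D` is the big-step evaluation relation `M ⇓ D` between terms and value
distributions. -/
inductive BigStep : Term → (Value →₀ ℝ) → Prop
  | omega : BigStep .omega 0
  | value {x : ℕ} {M : Term} (h : Affine {x} M) :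
      BigStep (.lam x M) (Finsupp.single ⟨x, M, h⟩ 1)
  | choice {M N : Term} {D E : Value →₀ ℝ} (hM : BigStep M D) (hN : BigStep N E) :
      BigStep (.choice M N) ((1 / 2 : ℝ) • D + (1 / 2 : ℝ) • E)
  | app {M N : Term} {D E : Value →₀ ℝ} {F : Value → Value → (Value →₀ ℝ)}
      (hM : BigStep M D) (hN : BigStep N E)
      (hF : ∀ W ∈ D.support, ∀ V ∈ E.support, BigStep (W.body.subst W.x V.toTerm) (F W V)) :
      BigStep (.app M N) (D.sum fun W p => E.sum fun V q => (p * q) • F W V)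

/-- A termination measure for the big-step semantics. -/
def Term.size : Term → ℕ
  | .var _ => 0
  | .lam _ M => M.size + 1
  | .app M N => M.size + N.size + 1
  | .choice M N => max M.size N.size + 1
  | .omega => 0

theorem Affine.size_subst_le {Γ : Finset ℕ} {M : Term} (x : ℕ) (V : Term) (h : Affine Γ M) :
    (M.subst x V).size ≤ M.size + if x ∈ Γ then V.size else 0 := by
  induction h with
  | @var Γ y hy =>
    simp only [Term.subst]
    split_ifs <;> simp_all [Term.size]
  | @lam Γ y M hM ih =>
    simp only [Term.subst]
    by_cases hyx : y = x
    · simp [hyx]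
    · have : (x ∈ insert y Γ) ↔ x ∈ Γ := by
        rw [Finset.mem_insert]; exact or_iff_right (fun h => hyx h.symm)
      simp only [this] at ih
      simp only [hyx, if_false, Term.size]
      omega
  | @app Γ Δ M N hd _ _ ih₁ ih₂ =>
    simp only [Term.subst, Term.size, Finset.mem_union]
    have hn : ¬ (x ∈ Γ ∧ x ∈ Δ) := fun h => Finset.disjoint_left.1 hd h.1 h.2
    by_cases h1 : x ∈ Γ <;> by_cases h2 : x ∈ Δ <;> simp [h1, h2] at ih₁ ih₂ hn ⊢ <;> omega
  | choice _ _ ih₁ ih₂ =>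
    simp only [Term.subst, Term.size]
    omega
  | omega => simp [Term.subst, Term.size]

theorem BigStep.unique {M : Term} {D : Value →₀ ℝ} (h : BigStep M D) :
    ∀ {D' : Value →₀ ℝ}, BigStep M D' → D = D' := by
  induction h with
  | omega => intro D' h'; cases h'; rfl
  | value _ => intro D' h'; cases h'; rfl
  | choice _ _ ih₁ ih₂ =>
    intro D' h'
    cases h' with
    | choice h₁ h₂ => rw [ih₁ h₁, ih₂ h₂]
  | app _ _ _ ih₁ ih₂ ih₃ =>
    intro D' h'
    cases h' with
    | app h₁ h₂ h₃ =>
      obtain rfl := ih₁ h₁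
      obtain rfl := ih₂ h₂
      refine Finset.sum_congr rfl fun W hW => Finset.sum_congr rfl fun V hV => ?_
      simp only [ih₃ W hW V hV (h₃ W hW V hV)]

theorem FinDistr.app_nonneg {D E : FinDistr Value} (F : Value → Value → FinDistr Value)
    (U : Value) : 0 ≤ (D.toFinsupp.sum fun W p => E.toFinsupp.sum fun V q =>
      (p * q) • (F W V).toFinsupp) U := by
  simp only [Finsupp.sum, Finsupp.coe_finsetSum, Finset.sum_apply, Finsupp.smul_apply,
    smul_eq_mul]
  exact Finset.sum_nonneg fun W _ => Finset.sum_nonneg fun V _ =>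
    mul_nonneg (mul_nonneg (D.nonneg W) (E.nonneg V)) ((F W V).nonneg U)

/-- The weight of a finitely supported function, as a linear map. -/
noncomputable def weight (S : Type) : (S →₀ ℝ) →ₗ[ℝ] ℝ := Finsupp.linearCombination ℝ fun _ => 1

theorem weight_apply {S : Type} (D : S →₀ ℝ) : weight S D = D.sum fun _ p => p := by
  simp [weight, Finsupp.linearCombination_apply]

theorem FinDistr.weight_nonneg {S : Type} (D : FinDistr S) : 0 ≤ weight S D.toFinsupp := by
  rw [weight_apply]; exact Finset.sum_nonneg fun s _ => D.nonneg s

theorem FinDistr.weight_le_one {S : Type} (D : FinDistr S) : weight S D.toFinsupp ≤ 1 := by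
  rw [weight_apply]; exact D.sum_le_one

theorem FinDistr.app_weight {D E : FinDistr Value} (F : Value → Value → FinDistr Value) :
    weight Value (D.toFinsupp.sum fun W p => E.toFinsupp.sum fun V q =>
      (p * q) • (F W V).toFinsupp) ≤ 1 := by
  simp only [Finsupp.sum, map_sum, map_smul, smul_eq_mul]
  have hE := E.sum_le_one
  have hD := D.sum_le_one
  simp only [Finsupp.sum] at hE hD
  refine le_trans (Finset.sum_le_sum fun W _ => ?_) hD
  calc _ ≤ ∑ V ∈ E.toFinsupp.support, D.toFinsupp W * E.toFinsupp V :=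
        Finset.sum_le_sum fun V _ => mul_le_of_le_one_right
          (mul_nonneg (D.nonneg W) (E.nonneg V)) (F W V).weight_le_one
    _ ≤ D.toFinsupp W := by
        rw [← Finset.mul_sum]; exact mul_le_of_le_one_right (D.nonneg W) hE

theorem BigStep.exists_of_size (n : ℕ) : ∀ M : Term, Affine ∅ M → M.size ≤ n →
    ∃ D : FinDistr Value, BigStep M D.toFinsupp ∧
      ∀ V ∈ D.toFinsupp.support, V.toTerm.size ≤ M.size := by
  classical
  induction n with
  | zero =>
    intro M hM hn
    cases M with
    | var x => simpa using hM.var_inv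
    | omega => exact ⟨FinDistr.empty _, .omega, by simp [FinDistr.empty]⟩
    | lam x M => simp [Term.size] at hn
    | app M N => simp [Term.size] at hn
    | choice M N => simp [Term.size] at hn
  | succ n ih =>
    intro M hM hn
    cases M with
    | var x => simpa using hM.var_inv
    | omega => exact ⟨FinDistr.empty _, .omega, by simp [FinDistr.empty]⟩
    | lam x M =>
      have h : Affine {x} M := hM.lam_inv
      refine ⟨FinDistr.dirac ⟨x, M, h⟩, .value h, fun V hV => ?_⟩
      have := Finset.mem_singleton.1 (Finsupp.support_single_subset hV)
      subst this
      exact le_rfl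
    | choice M N =>
      simp only [Term.size] at hn
      obtain ⟨h₁, h₂⟩ := hM.choice_inv
      obtain ⟨D, hD, hDs⟩ := ih M h₁ (by omega)
      obtain ⟨E, hE, hEs⟩ := ih N h₂ (by omega)
      refine ⟨⟨(1 / 2 : ℝ) • D.toFinsupp + (1 / 2 : ℝ) • E.toFinsupp, fun V => ?_, ?_⟩,
        .choice hD hE, fun V hV => ?_⟩
      · have := D.nonneg V
        have := E.nonneg V
        simp only [Finsupp.add_apply, Finsupp.smul_apply, smul_eq_mul]
        positivity
      · rw [← weight_apply, map_add, map_smul, map_smul, smul_eq_mul, smul_eq_mul]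
        linarith [D.weight_le_one, E.weight_le_one]
      · simp only [Term.size]
        rcases Finset.mem_union.1 (Finsupp.support_add hV) with h | h
        · have := hDs V (Finsupp.support_smul h); omega
        · have := hEs V (Finsupp.support_smul h); omega
    | app M N =>
      simp only [Term.size] at hn
      obtain ⟨h₁', h₂'⟩ := hM.app_inv
      obtain ⟨D, hD, hDs⟩ := ih M h₁' (by omega)
      obtain ⟨E, hE, hEs⟩ := ih N h₂' (by omega)
      have key : ∀ W V : Value, ∃ F : FinDistr Value, W ∈ D.toFinsupp.support →
          V ∈ E.toFinsupp.support → BigStep (W.body.subst W.x V.toTerm) F.toFinsupp ∧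
            ∀ U ∈ F.toFinsupp.support, U.toTerm.size ≤ M.size + N.size := by
        intro W V
        by_cases hWV : W ∈ D.toFinsupp.support ∧ V ∈ E.toFinsupp.support
        · have hs : (W.body.subst W.x V.toTerm).size ≤ W.body.size + V.toTerm.size := by
            refine (W.affine.size_subst_le W.x V.toTerm).trans ?_
            simp
          have hW := hDs W hWV.1
          have hV := hEs V hWV.2
          have hWs : W.toTerm.size = W.body.size + 1 := rfl
          obtain ⟨F, hF, hFs⟩ := ih _ (W.affine_beta V) (by omega)
          exact ⟨F, fun _ _ => ⟨hF, fun U hU => (hFs U hU).trans (by omega)⟩⟩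
        · exact ⟨FinDistr.empty _, fun h h' => absurd ⟨h, h'⟩ hWV⟩
      choose F hF using key
      refine ⟨⟨_, FinDistr.app_nonneg (D := D) (E := E) F, ?_⟩,
        .app hD hE fun W hW V hV => (hF W V hW hV).1, fun U hU => ?_⟩
      · rw [← weight_apply]; exact FinDistr.app_weight F
      · simp only [Term.size]
        by_contra hlt
        refine (Finsupp.mem_support_iff.1 hU) ?_
        simp only [Finsupp.sum, Finsupp.coe_finsetSum, Finset.sum_apply, Finsupp.smul_apply,
          smul_eq_mul]
        refine Finset.sum_eq_zero fun W hW => Finset.sum_eq_zero fun V hV => ?_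
        have : (F W V).toFinsupp U = 0 := by
          by_contra hne
          have := (hF W V hW hV).2 U (Finsupp.mem_support_iff.2 hne)
          omega
        rw [this, mul_zero]

theorem Program.exists_bigStep (M : Program) : ∃ D : FinDistr Value, BigStep M.1 D.toFinsupp :=
  let ⟨D, hD, _⟩ := BigStep.exists_of_size _ M.1 M.2 le_rfl
  ⟨D, hD⟩

/-- The semantics of a program: the unique value distribution to which it evaluates. -/
noncomputable def Program.sem (M : Program) : FinDistr Value := M.exists_bigStep.choose

theorem Program.bigStep_iff (M : Program) (D : Value →₀ ℝ) :
    BigStep M.1 D ↔ D = M.sem.toFinsupp :=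
  ⟨fun h => h.unique M.exists_bigStep.choose_spec, fun h => h ▸ M.exists_bigStep.choose_spec⟩

/-! ### Contexts -/

/-- Contexts. -/
inductive Ctx : Type
  | hole : Ctx
  | term (M : Term) : Ctx
  | lam (x : ℕ) (C : Ctx) : Ctx
  | appL (C : Ctx) (M : Term) : Ctx
  | appR (M : Term) (C : Ctx) : Ctx
  | choice (C D : Ctx) : Ctx

/-- `C.fill M` replaces the hole by `M` (only used with `M` closed). -/
def Ctx.fill : Ctx → Term → Term
  | .hole, M => M
  | .term N, _ => N
  | .lam x C, M => .lam x (C.fill M)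
  | .appL C N, M => .app (C.fill M) N
  | .appR N C, M => .app N (C.fill M)
  | .choice C D, M => .choice (C.fill M) (D.fill M)

/-- Affine contexts; the hole stands for a closed term. -/
inductive AffineCtx : Finset ℕ → Ctx → Prop
  | hole {Γ : Finset ℕ} : AffineCtx Γ .hole
  | term {Γ : Finset ℕ} {M : Term} (hM : Affine Γ M) : AffineCtx Γ (.term M)
  | lam {Γ : Finset ℕ} {x : ℕ} {C : Ctx} (hC : AffineCtx (insert x Γ) C) : AffineCtx Γ (.lam x C)
  | appL {Γ Δ : Finset ℕ} {C : Ctx} {M : Term} (hd : Disjoint Γ Δ) (hC : AffineCtx Γ C)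
      (hM : Affine Δ M) : AffineCtx (Γ ∪ Δ) (.appL C M)
  | appR {Γ Δ : Finset ℕ} {M : Term} {C : Ctx} (hd : Disjoint Γ Δ) (hM : Affine Γ M)
      (hC : AffineCtx Δ C) : AffineCtx (Γ ∪ Δ) (.appR M C)
  | choice {Γ : Finset ℕ} {C D : Ctx} (hC : AffineCtx Γ C) (hD : AffineCtx Γ D) :
      AffineCtx Γ (.choice C D)

theorem AffineCtx.affine_fill {Γ : Finset ℕ} {C : Ctx} (h : AffineCtx Γ C) {M : Term}
    (hM : Affine ∅ M) : Affine Γ (C.fill M) := by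
  induction h with
  | hole => exact hM.weaken (Finset.empty_subset _)
  | term hN => exact hN
  | lam _ ih => exact .lam ih
  | appL hd _ hN ih => exact .app hd ih hN
  | appR hd hN _ ih => exact .app hd hN ih
  | choice _ _ ih₁ ih₂ => exact .choice ih₁ ih₂

/-- Filling a closed affine context with a program gives a program. -/
def fillProgram (C : Ctx) (hC : AffineCtx ∅ C) (M : Program) : Program :=
  ⟨C.fill M.1, hC.affine_fill M.2⟩

/-! ### Pseudometrics -/

/-- Pseudometrics with values in `[0,1]`. -/
@[ext]
structure Pseudometric (S : Type) : Type where
  dist : S → S → ℝ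
  nonneg : ∀ s t, 0 ≤ dist s t
  le_one : ∀ s t, dist s t ≤ 1
  dist_self : ∀ s, dist s s = 0
  symm : ∀ s t, dist s t = dist t s
  triangle : ∀ s t u, dist s t ≤ dist s u + dist u t

namespace Pseudometric

variable {S : Type}

/-- Pseudometrics are ordered by the reverse of the pointwise order. -/
instance : PartialOrder (Pseudometric S) where
  le μ ρ := ∀ s t, ρ.dist s t ≤ μ.dist s t
  le_refl μ s t := le_rfl
  le_trans μ ρ ν h h' s t := (h' s t).trans (h s t)
  le_antisymm μ ρ h h' := by
    ext s t
    exact le_antisymm (h' s t) (h s t)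

theorem bddAbove_range (A : Set (Pseudometric S)) (s t : S) :
    BddAbove (Set.range fun μ : A => μ.1.dist s t) :=
  ⟨1, by rintro _ ⟨μ, rfl⟩; exact μ.1.le_one s t⟩

/-- Infima for the reversed order are pointwise suprema. -/
noncomputable instance : InfSet (Pseudometric S) where
  sInf A :=
    { dist := fun s t => ⨆ μ : A, μ.1.dist s t
      nonneg := fun s t => Real.iSup_nonneg fun μ => μ.1.nonneg s t
      le_one := fun s t => Real.iSup_le (fun μ => μ.1.le_one s t) zero_le_one
      dist_self := fun s => by simp [dist_self]
      symm := fun s t => by simp only [fun μ : A => μ.1.symm s t]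
      triangle := fun s t u => Real.iSup_le
        (fun μ => (μ.1.triangle s t u).trans (add_le_add (le_ciSup (bddAbove_range A s u) μ)
          (le_ciSup (bddAbove_range A u t) μ)))
        (add_nonneg (Real.iSup_nonneg fun μ => μ.1.nonneg s u)
          (Real.iSup_nonneg fun μ => μ.1.nonneg u t)) }

/-- Pseudometrics form a complete lattice. -/
noncomputable instance : CompleteLattice (Pseudometric S) :=
  completeLatticeOfInf _ fun A =>
    ⟨fun μ hμ s t => le_ciSup (bddAbove_range A s t) ⟨μ, hμ⟩,
      fun ρ hρ s t => Real.iSup_le (fun μ => hρ μ.2 s t) (ρ.nonneg s t)⟩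

/-- The restriction of a pseudometric along a map. -/
def comap {T : Type} (f : T → S) (μ : Pseudometric S) : Pseudometric T where
  dist s t := μ.dist (f s) (f t)
  nonneg _ _ := μ.nonneg _ _
  le_one _ _ := μ.le_one _ _
  dist_self _ := μ.dist_self _
  symm _ _ := μ.symm _ _
  triangle _ _ _ := μ.triangle _ _ _

end Pseudometric

/-! ### The Kantorovich lifting -/

section Lifting

variable {S : Type}

/-- Feasible points of the linear program that defines the lifting; the two finite supports
enumerate the states that matter. -/
structure IsPlan (D E : FinDistr S) (h : S → S → ℝ) (w z : S → ℝ) : Prop where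
  h_nonneg : ∀ i j, 0 ≤ h i j
  w_nonneg : ∀ i, 0 ≤ w i
  z_nonneg : ∀ j, 0 ≤ z j
  col : ∀ j ∈ E.toFinsupp.support, ∑ i ∈ D.toFinsupp.support, h i j + z j = E.toFinsupp j
  row : ∀ i ∈ D.toFinsupp.support, ∑ j ∈ E.toFinsupp.support, h i j + w i = D.toFinsupp i

/-- The objective function of the linear program. -/
noncomputable def planCost (μ : S → S → ℝ) (D E : FinDistr S) (h : S → S → ℝ) (w z : S → ℝ) : ℝ :=
  ∑ i ∈ D.toFinsupp.support, ∑ j ∈ E.toFinsupp.support, h i j * μ i j +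
    ∑ i ∈ D.toFinsupp.support, w i + ∑ j ∈ E.toFinsupp.support, z j

/-- The values of the objective function at the feasible points. -/
def planCosts (μ : S → S → ℝ) (D E : FinDistr S) : Set ℝ :=
  {c | ∃ h w z, IsPlan D E h w z ∧ c = planCost μ D E h w z}

/-- The lifting of `μ` to finite distributions: the optimum of the linear program. -/
noncomputable def lift (μ : S → S → ℝ) (D E : FinDistr S) : ℝ := sInf (planCosts μ D E)

theorem planCosts_nonneg {μ : S → S → ℝ} (hμ : ∀ s t, 0 ≤ μ s t) {D E : FinDistr S} {c : ℝ}
    (hc : c ∈ planCosts μ D E) : 0 ≤ c := by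
  obtain ⟨h, w, z, hp, rfl⟩ := hc
  have h1 := hp.h_nonneg
  have h2 := hp.w_nonneg
  have h3 := hp.z_nonneg
  unfold planCost
  exact add_nonneg (add_nonneg (Finset.sum_nonneg fun i _ => Finset.sum_nonneg fun j _ =>
    mul_nonneg (h1 i j) (hμ i j)) (Finset.sum_nonneg fun i _ => h2 i))
    (Finset.sum_nonneg fun j _ => h3 j)

theorem bddBelow_planCosts {μ : S → S → ℝ} (hμ : ∀ s t, 0 ≤ μ s t) (D E : FinDistr S) :
    BddBelow (planCosts μ D E) := ⟨0, fun _ hc => planCosts_nonneg hμ hc⟩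

theorem planCosts_nonempty (μ : S → S → ℝ) (D E : FinDistr S) : (planCosts μ D E).Nonempty :=
  ⟨_, fun _ _ => 0, fun i => D.toFinsupp i, fun j => E.toFinsupp j,
    ⟨fun _ _ => le_rfl, D.nonneg, E.nonneg, by simp, by simp⟩, rfl⟩

theorem lift_nonneg {μ : S → S → ℝ} (hμ : ∀ s t, 0 ≤ μ s t) (D E : FinDistr S) :
    0 ≤ lift μ D E := Real.sInf_nonneg fun _ hc => planCosts_nonneg hμ hc

theorem lift_self {μ : S → S → ℝ} (hμ : ∀ s t, 0 ≤ μ s t) (h0 : ∀ s, μ s s = 0)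
    (D : FinDistr S) : lift μ D D = 0 := by
  classical
  refine le_antisymm (csInf_le (bddBelow_planCosts hμ D D)
    ⟨fun i j => if i = j then D.toFinsupp i else 0, fun _ => 0, fun _ => 0,
      ⟨fun i j => ?_, fun _ => le_rfl, fun _ => le_rfl, fun j hj => ?_, fun i hi => ?_⟩, ?_⟩)
    (lift_nonneg hμ D D)
  · split_ifs
    exacts [D.nonneg i, le_rfl]
  · simp only [Finset.sum_ite_eq', hj, if_true, add_zero]
  · simp only [Finset.sum_ite_eq, hi, if_true, add_zero]
  · simp only [planCost, ite_mul, zero_mul, Finset.sum_ite_eq, h0, mul_zero, ite_self,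
      Finset.sum_const_zero, add_zero]

theorem lift_comm_le {μ : S → S → ℝ} (hμ : ∀ s t, 0 ≤ μ s t) (hs : ∀ s t, μ s t = μ t s)
    (D E : FinDistr S) : lift μ D E ≤ lift μ E D := by
  refine le_csInf (planCosts_nonempty μ E D) ?_
  rintro _ ⟨h, w, z, hp, rfl⟩
  refine csInf_le (bddBelow_planCosts hμ D E)
    ⟨fun i j => h j i, z, w, ⟨fun i j => hp.h_nonneg j i, hp.z_nonneg, hp.w_nonneg, hp.row,
      hp.col⟩, ?_⟩
  unfold planCost
  rw [Finset.sum_comm]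
  simp only [add_right_comm, fun i j => hs i j]

theorem lift_mono {μ ρ : S → S → ℝ} (hμ : ∀ s t, 0 ≤ μ s t) (hle : ∀ s t, μ s t ≤ ρ s t)
    (D E : FinDistr S) : lift μ D E ≤ lift ρ D E := by
  refine le_csInf (planCosts_nonempty ρ D E) ?_
  rintro _ ⟨h, w, z, hp, rfl⟩
  refine (csInf_le (bddBelow_planCosts hμ D E) ⟨h, w, z, hp, rfl⟩).trans ?_
  have := hp.h_nonneg
  unfold planCost
  gcongr
  · exact this _ _
  · exact hle _ _

theorem lift_le_one {μ : S → S → ℝ} (hμ : ∀ s t, 0 ≤ μ s t) (h1 : ∀ s t, μ s t ≤ 1)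
    (D E : FinDistr S) : lift μ D E ≤ 1 := by
  set p : ℝ := ∑ i ∈ D.toFinsupp.support, D.toFinsupp i with hp
  set q : ℝ := ∑ j ∈ E.toFinsupp.support, E.toFinsupp j with hq
  have hp1 : p ≤ 1 := D.sum_le_one
  have hq1 : q ≤ 1 := E.sum_le_one
  refine (csInf_le (bddBelow_planCosts hμ D E)
    ⟨fun i j => D.toFinsupp i * E.toFinsupp j, fun i => D.toFinsupp i * (1 - q),
      fun j => (1 - p) * E.toFinsupp j, ⟨fun i j => mul_nonneg (D.nonneg i) (E.nonneg j),
      fun i => mul_nonneg (D.nonneg i) (sub_nonneg.2 hq1),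
      fun j => mul_nonneg (sub_nonneg.2 hp1) (E.nonneg j),
      fun j _ => ?_, fun i _ => ?_⟩, rfl⟩).trans ?_
  · rw [← Finset.sum_mul, ← hp]; ring
  · rw [← Finset.mul_sum, ← hq]; ring
  · unfold planCost
    have : ∑ i ∈ D.toFinsupp.support, ∑ j ∈ E.toFinsupp.support,
        D.toFinsupp i * E.toFinsupp j * μ i j ≤ p * q := by
      rw [hp, hq, Finset.sum_mul_sum]
      exact Finset.sum_le_sum fun i _ => Finset.sum_le_sum fun j _ =>
        mul_le_of_le_one_right (mul_nonneg (D.nonneg i) (E.nonneg j)) (h1 i j)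
    rw [← Finset.sum_mul, ← Finset.mul_sum, ← hp, ← hq]
    nlinarith [mul_nonneg (sub_nonneg.2 hp1) (sub_nonneg.2 hq1)]

theorem exists_plan_trans {μ : S → S → ℝ} (hμ : ∀ s t, 0 ≤ μ s t)
    (ht : ∀ s t u, μ s t ≤ μ s u + μ u t) (D E G : FinDistr S) {c d : ℝ}
    (hc : c ∈ planCosts μ D E) (hd : d ∈ planCosts μ E G) :
    ∃ e ∈ planCosts μ D G, e ≤ c + d := by
  obtain ⟨l, x, y, ⟨l0, x0, y0, lcol, lrow⟩, rfl⟩ := hc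
  obtain ⟨h, w, z, ⟨h0, w0, z0, hcol, hrow⟩, rfl⟩ := hd
  set A := D.toFinsupp.support
  set B := E.toFinsupp.support with hB
  set K := G.toFinsupp.support
  set r : S → ℝ := fun j => (E.toFinsupp j)⁻¹ with hr
  have r0 : ∀ j, 0 ≤ r j := fun j => inv_nonneg.2 (E.nonneg j)
  have rE : ∀ j ∈ B, E.toFinsupp j * r j = 1 := fun j hj =>
    mul_inv_cancel₀ (Finsupp.mem_support_iff.1 hj)
  have hn : ∀ i j k, 0 ≤ l i j * r j * h j k := fun i j k =>
    mul_nonneg (mul_nonneg (l0 i j) (r0 j)) (h0 j k)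
  -- the two normalisation identities
  have eq1 : ∀ i, ∀ j ∈ B, ∑ k ∈ K, l i j * r j * h j k + l i j * r j * w j = l i j := by
    intro i j hj
    rw [← Finset.mul_sum, ← mul_add, hrow j hj, mul_assoc, mul_comm (r j), rE j hj, mul_one]
  have eq2 : ∀ k, ∀ j ∈ B, ∑ i ∈ A, l i j * r j * h j k + y j * r j * h j k = h j k := by
    intro k j hj
    rw [← Finset.sum_mul, ← Finset.sum_mul, ← add_mul, ← add_mul, lcol j hj, rE j hj, one_mul]
  refine ⟨_, ⟨fun i k => ∑ j ∈ B, l i j * r j * h j k, fun i => x i + ∑ j ∈ B, l i j * r j * w j,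
    fun k => z k + ∑ j ∈ B, y j * r j * h j k, ⟨fun i k => Finset.sum_nonneg fun j _ => hn i j k,
      fun i => add_nonneg (x0 i) (Finset.sum_nonneg fun j _ =>
        mul_nonneg (mul_nonneg (l0 i j) (r0 j)) (w0 j)),
      fun k => add_nonneg (z0 k) (Finset.sum_nonneg fun j _ =>
        mul_nonneg (mul_nonneg (y0 j) (r0 j)) (h0 j k)), fun k hk => ?_, fun i hi => ?_⟩, rfl⟩, ?_⟩
  · rw [Finset.sum_comm, add_left_comm, ← Finset.sum_add_distrib, Finset.sum_congr rfl (eq2 k),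
      add_comm, hcol k hk]
  · rw [Finset.sum_comm, add_left_comm, ← Finset.sum_add_distrib, Finset.sum_congr rfl (eq1 i),
      add_comm, lrow i hi]
  · unfold planCost
    have b1 : ∑ i ∈ A, ∑ k ∈ K, (∑ j ∈ B, l i j * r j * h j k) * μ i k ≤
        ∑ i ∈ A, ∑ j ∈ B, (∑ k ∈ K, l i j * r j * h j k) * μ i j +
          ∑ j ∈ B, ∑ k ∈ K, (∑ i ∈ A, l i j * r j * h j k) * μ j k := by
      calc _ ≤ ∑ i ∈ A, ∑ k ∈ K, ∑ j ∈ B, (l i j * r j * h j k * μ i j +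
            l i j * r j * h j k * μ j k) := by
            refine Finset.sum_le_sum fun i _ => Finset.sum_le_sum fun k _ => ?_
            rw [Finset.sum_mul]
            refine Finset.sum_le_sum fun j _ => ?_
            rw [← mul_add]
            exact mul_le_mul_of_nonneg_left (ht i k j) (hn i j k)
        _ = _ := by
            simp only [Finset.sum_add_distrib, Finset.sum_mul]
            congr 1
            · exact Finset.sum_congr rfl fun i _ => Finset.sum_comm
            · rw [Finset.sum_comm]
              rw [Finset.sum_congr rfl fun k _ => Finset.sum_comm]
              rw [Finset.sum_comm]
    have b2 : ∑ i ∈ A, ∑ j ∈ B, (∑ k ∈ K, l i j * r j * h j k) * μ i j ≤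
        ∑ i ∈ A, ∑ j ∈ B, l i j * μ i j := by
      refine Finset.sum_le_sum fun i _ => Finset.sum_le_sum fun j hj =>
        mul_le_mul_of_nonneg_right ?_ (hμ i j)
      have := mul_nonneg (mul_nonneg (l0 i j) (r0 j)) (w0 j)
      linarith [eq1 i j hj]
    have b3 : ∑ j ∈ B, ∑ k ∈ K, (∑ i ∈ A, l i j * r j * h j k) * μ j k ≤
        ∑ j ∈ B, ∑ k ∈ K, h j k * μ j k := by
      refine Finset.sum_le_sum fun j hj => Finset.sum_le_sum fun k _ =>
        mul_le_mul_of_nonneg_right ?_ (hμ j k)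
      have := mul_nonneg (mul_nonneg (y0 j) (r0 j)) (h0 j k)
      linarith [eq2 k j hj]
    have b4 : ∑ i ∈ A, ∑ j ∈ B, l i j * r j * w j ≤ ∑ j ∈ B, w j := by
      rw [Finset.sum_comm]
      refine Finset.sum_le_sum fun j hj => ?_
      rw [← Finset.sum_mul, ← Finset.sum_mul]
      refine mul_le_of_le_one_left (w0 j) ?_
      rw [← rE j hj]
      exact mul_le_mul_of_nonneg_right (by linarith [lcol j hj, y0 j]) (r0 j)
    have b5 : ∑ k ∈ K, ∑ j ∈ B, y j * r j * h j k ≤ ∑ j ∈ B, y j := by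
      rw [Finset.sum_comm]
      refine Finset.sum_le_sum fun j hj => ?_
      rw [← Finset.mul_sum, mul_assoc]
      refine mul_le_of_le_one_right (y0 j) ?_
      rw [mul_comm, ← rE j hj]
      exact mul_le_mul_of_nonneg_right (by linarith [hrow j hj, w0 j]) (r0 j)
    simp only [Finset.sum_add_distrib]
    linarith

theorem lift_triangle {μ : S → S → ℝ} (hμ : ∀ s t, 0 ≤ μ s t)
    (ht : ∀ s t u, μ s t ≤ μ s u + μ u t) (D E G : FinDistr S) :
    lift μ D G ≤ lift μ D E + lift μ E G := by
  have key : ∀ c ∈ planCosts μ D E, ∀ d ∈ planCosts μ E G, lift μ D G ≤ c + d := by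
    intro c hc d hd
    obtain ⟨e, he, hle⟩ := exists_plan_trans hμ ht D E G hc hd
    exact (csInf_le (bddBelow_planCosts hμ D G) he).trans hle
  have h1 : ∀ d ∈ planCosts μ E G, lift μ D G - d ≤ lift μ D E := fun d hd =>
    le_csInf (planCosts_nonempty μ D E) fun c hc => by linarith [key c hc d hd]
  have h2 : lift μ D G - lift μ D E ≤ lift μ E G :=
    le_csInf (planCosts_nonempty μ E G) fun d hd => by linarith [h1 d hd]
  linarith

end Lifting

/-! ### Labelled Markov chains and the bisimulation metric -/

/-- Image-finite labelled Markov chains with states `S` and labels `L`. -/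
structure LMC (S L : Type) : Type where
  countable_states : Countable S
  countable_labels : Countable L
  trans : S → L → FinDistr S

/-- The operator `F` on the pseudometrics over the states of a labelled Markov chain. -/
noncomputable def bisimOperator {S L : Type} (K : LMC S L) : Pseudometric S →o Pseudometric S where
  toFun μ :=
    { dist := fun s t => ⨆ a : L, lift μ.dist (K.trans s a) (K.trans t a)
      nonneg := fun s t => Real.iSup_nonneg fun a => lift_nonneg μ.nonneg _ _
      le_one := fun s t => Real.iSup_le (fun a => lift_le_one μ.nonneg μ.le_one _ _) zero_le_one
      dist_self := fun s => by simp [lift_self μ.nonneg μ.dist_self]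
      symm := fun s t => by
        congr 1; funext a
        exact le_antisymm (lift_comm_le μ.nonneg μ.symm _ _) (lift_comm_le μ.nonneg μ.symm _ _)
      triangle := fun s t u => by
        have hb : ∀ s t, BddAbove (Set.range fun a : L =>
            lift μ.dist (K.trans s a) (K.trans t a)) := fun s t =>
          ⟨1, by rintro _ ⟨a, rfl⟩; exact lift_le_one μ.nonneg μ.le_one _ _⟩
        exact Real.iSup_le (fun a => (lift_triangle μ.nonneg μ.triangle _ _ _).trans
            (add_le_add (le_ciSup (hb s u) a) (le_ciSup (hb u t) a)))
          (add_nonneg (Real.iSup_nonneg fun a => lift_nonneg μ.nonneg _ _)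
            (Real.iSup_nonneg fun a => lift_nonneg μ.nonneg _ _)) }
  monotone' := fun μ ρ hle s t => by
    have hb : BddAbove (Set.range fun a : L => lift μ.dist (K.trans s a) (K.trans t a)) :=
      ⟨1, by rintro _ ⟨a, rfl⟩; exact lift_le_one μ.nonneg μ.le_one _ _⟩
    exact Real.iSup_le (fun a => (lift_mono ρ.nonneg hle _ _).trans (le_ciSup hb a))
      (Real.iSup_nonneg fun a => lift_nonneg μ.nonneg _ _)

/-- The bisimulation metric of a labelled Markov chain. -/
noncomputable def bisimMetric {S L : Type} (K : LMC S L) : Pseudometric S :=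
  OrderHom.gfp (bisimOperator K)

/-! ### The labelled Markov chain of the calculus -/

/-- States: programs and distinguished values. -/
inductive State : Type
  | prog (M : Program) : State
  | dval (V : Value) : State

/-- Labels: evaluation, and the passing of a value. -/
inductive Label : Type
  | eval : Label
  | pass (V : Value) : Label

instance : Countable State :=
  Function.Injective.countable (f := fun s : State => match s with
    | .prog M => (Sum.inl M : Program ⊕ Value)
    | .dval V => Sum.inr V) (by rintro (_ | _) (_ | _) h <;> simp_all)

instance : Countable Label :=
  Function.Injective.countable (f := fun a : Label => match a with
    | .eval => (none : Option Value)
    | .pass V => some V) (by rintro (_ | _) (_ | _) h <;> simp_all)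

/-- Distinguished values as an injection into the states. -/
def dvalEmb : Value ↪ State := ⟨State.dval, fun _ _ h => State.dval.inj h⟩

/-- A program is evaluated to the distinguished values of its semantics; a distinguished value
`λx.M` that receives `V` becomes the program `M{V/x}`; there are no other transitions. -/
noncomputable def lambdaLMC : LMC State Label where
  countable_states := inferInstance
  countable_labels := inferInstance
  trans
    | .prog M, .eval => M.sem.map dvalEmb
    | .dval W, .pass V => FinDistr.dirac (.prog (W.beta V))
    | .prog _, .pass _ => FinDistr.empty State
    | .dval _, .eval => FinDistr.empty State

/-- The bisimulation distance on programs. -/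
noncomputable def bisimDistance : Pseudometric Program :=
  (bisimMetric lambdaLMC).comap State.prog

/-- Non-expansiveness of a pseudometric on programs. -/
def NonExpansive (μ : Pseudometric Program) : Prop :=
  ∀ (C : Ctx) (hC : AffineCtx ∅ C) (M N : Program),
    μ.dist (fillProgram C hC M) (fillProgram C hC N) ≤ μ.dist M N

end AffineProb

namespace AffineProb

/-! ### Couplings as finitely supported functions -/

/-! The operator is monotone on a complete lattice, so Knaster–Tarski makes `bisimMetric` its
greatest fixpoint. Non-expansiveness is a quantitative form of Howe's method.

The relation `Howe Γ ε M N` closes the bisimulation distance under the term constructors while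
tracking a cost: costs add up in an application, are shared by the two branches of a choice, and
increase by the distance travelled when a closed term is moved. Filling a context with two programs
therefore yields related terms at cost `bisimDistance.dist M N`. Affinity enters in `Howe.subst`: a
variable occurs free on at most one side of an application, so the cost of the substituted term is
paid at most once.

The central fact is `BigStep.lift_howeCost_le`: programs related at cost `ε` evaluate to
distributions at most `ε` apart in the lifting of `howeCost`. It is proved by induction on the
evaluation of the left program. For an application, the couplings of the functions and of the
arguments are composed by `Coupled.bind`. Couplings in the form `Coupled` make this practical:
unlike plans, they are not tied to the supports of two fixed distributions, so they can be added,
scaled and pushed forward.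

It remains to conclude by coinduction, although no symmetry or triangle inequality is available for
the Howe cost. Instead of a closure of the Howe cost, the proof uses the pointwise largest
pseudometric bounded by it, `sInf howeBounded`. The operator preserves `howeBounded`, so this
pseudometric is a post-fixpoint and lies below `bisimMetric` in the reversed order; hence the
bisimulation distance is itself bounded by every Howe cost. -/

theorem weight_mono {S : Type} {D E : S →₀ ℝ} (h : D ≤ E) : weight S D ≤ weight S E := by
  rw [← sub_nonneg, ← map_sub, weight_apply]
  exact Finset.sum_nonneg fun s _ => by simpa using h s

theorem linearCombination_nonneg {S T : Type} {f : S → T →₀ ℝ} (hf : ∀ s, 0 ≤ f s) {D : S →₀ ℝ}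
    (hD : 0 ≤ D) : 0 ≤ Finsupp.linearCombination ℝ f D := by
  rw [Finsupp.linearCombination_apply]
  exact Finset.sum_nonneg fun s _ => smul_nonneg (hD s) (hf s)

theorem weight_linearCombination_le {S T : Type} {f : S → T →₀ ℝ} (hf : ∀ s, weight T (f s) ≤ 1)
    {D : S →₀ ℝ} (hD : 0 ≤ D) : weight T (Finsupp.linearCombination ℝ f D) ≤ weight S D := by
  rw [Finsupp.linearCombination_apply, weight_apply D, Finsupp.sum, map_sum]
  refine Finset.sum_le_sum fun s _ => ?_
  rw [map_smul, smul_eq_mul]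
  exact mul_le_of_le_one_right (hD s) (hf s)

theorem weight_mapDomain {S T : Type} (f : S → T) (D : S →₀ ℝ) :
    weight T (D.mapDomain f) = weight S D := by
  simp [weight, Finsupp.linearCombination_mapDomain, Function.comp_def]

/-- Nonnegativity rules out cancellation: the mass of `H` at `p` survives in the image at `f p`. -/
theorem support_subset_of_mapDomain_add {S T : Type} {f : S → T} {H : S →₀ ℝ} {w : T →₀ ℝ}
    (hH : 0 ≤ H) (hw : 0 ≤ w) {p : S} (hp : p ∈ H.support) :
    f p ∈ (H.mapDomain f + w).support := by
  classical
  have hpos : 0 < H p := lt_of_le_of_ne (hH p) (Finsupp.mem_support_iff.1 hp).symm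
  have hle : Finsupp.single p (H p) ≤ H := fun q => by
    rw [Finsupp.single_apply]
    split_ifs with h
    · rw [h]
    · exact hH q
  have h1 := Finsupp.mapDomain_mono (f := f) hle (f p)
  have h2 : 0 ≤ w (f p) := hw (f p)
  rw [Finsupp.mapDomain_single, Finsupp.single_eq_same] at h1
  rw [Finsupp.mem_support_iff, Finsupp.add_apply]
  linarith

/-- `D` can be transported to `E` at cost at most `r`, where the transport of mass from `s` to `t`
costs `μ s t` and the creation or destruction of mass costs `1`. -/
def Coupled {S : Type} (μ : S → S → ℝ) (D E : S →₀ ℝ) (r : ℝ) : Prop :=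
  ∃ (H : S × S →₀ ℝ) (w z : S →₀ ℝ), 0 ≤ H ∧ 0 ≤ w ∧ 0 ≤ z ∧
    D = H.mapDomain Prod.fst + w ∧ E = H.mapDomain Prod.snd + z ∧
    Finsupp.linearCombination ℝ (fun p : S × S => μ p.1 p.2) H + weight S w + weight S z ≤ r

namespace Coupled

variable {S : Type} {μ : S → S → ℝ} {D D' E E' : S →₀ ℝ} {r r' : ℝ}

theorem mono (h : Coupled μ D E r) (hr : r ≤ r') : Coupled μ D E r' := by
  obtain ⟨H, w, z, h1, h2, h3, h4, h5, h6⟩ := h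
  exact ⟨H, w, z, h1, h2, h3, h4, h5, h6.trans hr⟩

theorem add (h : Coupled μ D E r) (h' : Coupled μ D' E' r') :
    Coupled μ (D + D') (E + E') (r + r') := by
  obtain ⟨H, w, z, h1, h2, h3, rfl, rfl, h6⟩ := h
  obtain ⟨H', w', z', h1', h2', h3', rfl, rfl, h6'⟩ := h'
  refine ⟨H + H', w + w', z + z', add_nonneg h1 h1', add_nonneg h2 h2', add_nonneg h3 h3',
    ?_, ?_, ?_⟩
  · rw [Finsupp.mapDomain_add]; abel
  · rw [Finsupp.mapDomain_add]; abel
  · simp only [map_add]; linarith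

theorem smul (h : Coupled μ D E r) {a : ℝ} (ha : 0 ≤ a) : Coupled μ (a • D) (a • E) (a * r) := by
  obtain ⟨H, w, z, h1, h2, h3, rfl, rfl, h6⟩ := h
  refine ⟨a • H, a • w, a • z, smul_nonneg ha h1, smul_nonneg ha h2, smul_nonneg ha h3, ?_, ?_, ?_⟩
  · rw [Finsupp.mapDomain_smul, smul_add]
  · rw [Finsupp.mapDomain_smul, smul_add]
  · simp only [map_smul, smul_eq_mul]
    rw [← mul_add, ← mul_add]
    exact mul_le_mul_of_nonneg_left h6 ha

theorem create (hD : 0 ≤ D) : Coupled μ 0 D (weight S D) :=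
  ⟨0, 0, D, le_rfl, le_rfl, hD, by simp, by simp, by simp⟩

theorem destroy (hD : 0 ≤ D) : Coupled μ D 0 (weight S D) :=
  ⟨0, D, 0, le_rfl, hD, le_rfl, by simp, by simp, by simp⟩

theorem single (μ : S → S → ℝ) (s t : S) {a : ℝ} (ha : 0 ≤ a) :
    Coupled μ (Finsupp.single s a) (Finsupp.single t a) (a * μ s t) :=
  ⟨Finsupp.single (s, t) a, 0, 0, Finsupp.single_nonneg.2 ha, le_rfl, le_rfl, by simp, by simp,
    by simp⟩

theorem sum {ι : Type} (A : Finset ι) {D E : ι → S →₀ ℝ} {r : ι → ℝ}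
    (h : ∀ i ∈ A, Coupled μ (D i) (E i) (r i)) :
    Coupled μ (∑ i ∈ A, D i) (∑ i ∈ A, E i) (∑ i ∈ A, r i) := by
  classical
  induction A using Finset.induction_on with
  | empty => simpa using (create (μ := μ) (le_refl (0 : S →₀ ℝ)))
  | insert i A hi ih =>
    rw [Finset.sum_insert hi, Finset.sum_insert hi, Finset.sum_insert hi]
    exact (h i (Finset.mem_insert_self i A)).add
      (ih fun j hj => h j (Finset.mem_insert_of_mem hj))

/-- Couplings push forward along kernels. -/
theorem bind {T : Type} {ν : T → T → ℝ} {f g : S → T →₀ ℝ} {k : ℝ} (h : Coupled μ D E r)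
    (hD : weight S D ≤ 1) (hk : 0 ≤ k) (hf : ∀ s, 0 ≤ f s) (hg : ∀ s, 0 ≤ g s)
    (hf1 : ∀ s, weight T (f s) ≤ 1) (hg1 : ∀ s, weight T (g s) ≤ 1)
    (hfg : ∀ s ∈ D.support, ∀ t, Coupled ν (f s) (g t) (μ s t + k)) :
    Coupled ν (Finsupp.linearCombination ℝ f D) (Finsupp.linearCombination ℝ g E) (r + k) := by
  obtain ⟨H, w, z, h1, h2, h3, hDe, rfl, h6⟩ := h
  have hsupp : ∀ p ∈ H.support, p.1 ∈ D.support := by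
    intro p hp
    rw [hDe]
    exact support_subset_of_mapDomain_add h1 h2 hp
  have hH : weight _ H ≤ 1 := by
    rw [hDe, map_add, weight_mapDomain] at hD
    have := weight_mono h2
    rw [map_zero] at this
    linarith
  -- Matched mass is coupled pairwise; the images of the unmatched parts `w` and `z` are destroyed
  -- and created, which costs no more than before because the kernels have weight at most one.
  have key := ((sum (μ := ν) H.support fun p hp => (hfg p.1 (hsupp p hp) p.2).smul (h1 p)).add
    (destroy (linearCombination_nonneg hf h2))).add (create (linearCombination_nonneg hg h3))
  rw [hDe, map_add, map_add, Finsupp.linearCombination_mapDomain,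
    Finsupp.linearCombination_mapDomain]
  simp only [add_zero] at key
  refine key.mono ?_
  have e1 := weight_linearCombination_le hf1 h2
  have e2 := weight_linearCombination_le hg1 h3
  rw [Finsupp.linearCombination_apply, Finsupp.sum] at h6
  rw [weight_apply, Finsupp.sum] at hH
  simp only [smul_eq_mul, mul_add, Finset.sum_add_distrib, ← Finset.sum_mul] at h6 ⊢
  -- The constant `k` is charged in proportion to the matched mass, which is at most one.
  have := mul_le_of_le_one_left hk hH
  linarith

end Coupled

/-! ### Couplings and the lifting -/

section

variable {S : Type}

/-- A plan is a finite sum of couplings of point masses, with its slack variables as creations and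
destructions. -/
theorem coupled_of_isPlan (μ : S → S → ℝ) {D E : FinDistr S} {h : S → S → ℝ} {w z : S → ℝ}
    (hp : IsPlan D E h w z) : Coupled μ D.toFinsupp E.toFinsupp (planCost μ D E h w z) := by
  have key := ((Coupled.sum (μ := μ) D.toFinsupp.support fun i _ =>
    Coupled.sum E.toFinsupp.support fun j _ => Coupled.single μ i j (hp.h_nonneg i j)).add
    (Coupled.sum D.toFinsupp.support fun i _ =>
      Coupled.destroy ((Finsupp.single_nonneg (i := i)).2 (hp.w_nonneg i)))).add
    (Coupled.sum E.toFinsupp.support fun j _ =>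
      Coupled.create ((Finsupp.single_nonneg (i := j)).2 (hp.z_nonneg j)))
  convert key using 1
  · rw [Finset.sum_const_zero, add_zero, ← Finset.sum_add_distrib]
    conv_lhs => rw [← Finsupp.sum_single D.toFinsupp]
    refine Finset.sum_congr rfl fun i hi => ?_
    rw [← Finsupp.single_finsetSum, ← Finsupp.single_add, hp.row i hi]
  · rw [Finset.sum_const_zero, add_zero, Finset.sum_comm, ← Finset.sum_add_distrib]
    conv_lhs => rw [← Finsupp.sum_single E.toFinsupp]
    refine Finset.sum_congr rfl fun j hj => ?_
    rw [← Finsupp.single_finsetSum, ← Finsupp.single_add, hp.col j hj]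
  · simp [planCost, weight]

theorem lift_le_of_coupled {μ : S → S → ℝ} (hμ : ∀ s t, 0 ≤ μ s t) {D E : FinDistr S} {r : ℝ}
    (h : Coupled μ D.toFinsupp E.toFinsupp r) : lift μ D E ≤ r := by
  classical
  obtain ⟨H, w, z, h1, h2, h3, hD, hE, h6⟩ := h
  set A := D.toFinsupp.support with hA
  set B := E.toFinsupp.support with hB
  -- By nonnegativity a coupling lives on the supports of its marginals, so it can be read as a
  -- plan.
  have hsub : H.support ⊆ A ×ˢ B := by
    intro p hp
    rw [Finset.mem_product, hA, hB, hD, hE]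
    exact ⟨support_subset_of_mapDomain_add h1 h2 hp, support_subset_of_mapDomain_add h1 h3 hp⟩
  have hwsub : w.support ⊆ A := by
    intro i hi
    have := support_subset_of_mapDomain_add (f := id) h2
      (Finsupp.mapDomain_nonneg (f := Prod.fst) h1) hi
    rwa [Finsupp.mapDomain_id, add_comm, ← hD] at this
  have hzsub : z.support ⊆ B := by
    intro i hi
    have := support_subset_of_mapDomain_add (f := id) h3
      (Finsupp.mapDomain_nonneg (f := Prod.snd) h1) hi
    rwa [Finsupp.mapDomain_id, add_comm, ← hE] at this
  refine (csInf_le (bddBelow_planCosts hμ D E) ⟨fun i j => H (i, j), w, z,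
    ⟨fun i j => h1 (i, j), h2, h3, fun j hj => ?_, fun i hi => ?_⟩, rfl⟩).trans (le_trans ?_ h6)
  · rw [hE, Finsupp.add_apply, Finsupp.mapDomain, Finsupp.sum_of_support_subset _ hsub _ (by simp),
      Finset.sum_product, Finsupp.finsetSum_apply]
    simp only [Finsupp.finsetSum_apply, Finsupp.single_apply, Finset.sum_ite_eq']
    simp only [show j ∈ B from hj, if_true, hA]
  · rw [hD, Finsupp.add_apply, Finsupp.mapDomain, Finsupp.sum_of_support_subset _ hsub _ (by simp),
      Finset.sum_product_right, Finsupp.finsetSum_apply]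
    simp only [Finsupp.finsetSum_apply, Finsupp.single_apply, Finset.sum_ite_eq']
    simp only [show i ∈ A from hi, if_true, hB]
  · rw [Finsupp.linearCombination_apply, weight_apply, weight_apply,
      Finsupp.sum_of_support_subset _ hsub _ (by simp), Finset.sum_product,
      Finsupp.sum_of_support_subset _ hwsub _ (by simp),
      Finsupp.sum_of_support_subset _ hzsub _ (by simp)]
    rfl

/-- The inequality is strict because the lifting is used only as an infimum; this is the source of
the small slacks in later proofs. -/
theorem Coupled.of_lift_lt {μ : S → S → ℝ} {D E : FinDistr S} {r : ℝ} (h : lift μ D E < r) :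
    Coupled μ D.toFinsupp E.toFinsupp r := by
  obtain ⟨_, ⟨h, w, z, hp, rfl⟩, hlt⟩ := exists_lt_of_csInf_lt (planCosts_nonempty μ D E) h
  exact (coupled_of_isPlan μ hp).mono hlt.le

/-- The gluing of `exists_plan_trans`, with separate functions for the two legs and for the
composite. It will be applied with a Howe cost on the first leg and the bisimulation distance on the
second. -/
theorem exists_plan_trans_of_le {μ ν ρ : S → S → ℝ} (hμ : ∀ s t, 0 ≤ μ s t)
    (hν : ∀ s t, 0 ≤ ν s t) (ht : ∀ s u t, ρ s t ≤ μ s u + ν u t) (D E G : FinDistr S) {c d : ℝ}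
    (hc : c ∈ planCosts μ D E) (hd : d ∈ planCosts ν E G) :
    ∃ e ∈ planCosts ρ D G, e ≤ c + d := by
  obtain ⟨l, x, y, ⟨l0, x0, y0, lcol, lrow⟩, rfl⟩ := hc
  obtain ⟨h, w, z, ⟨h0, w0, z0, hcol, hrow⟩, rfl⟩ := hd
  set A := D.toFinsupp.support
  set B := E.toFinsupp.support with hB
  set K := G.toFinsupp.support
  set r : S → ℝ := fun j => (E.toFinsupp j)⁻¹ with hr
  have r0 : ∀ j, 0 ≤ r j := fun j => inv_nonneg.2 (E.nonneg j)
  have rE : ∀ j ∈ B, E.toFinsupp j * r j = 1 := fun j hj =>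
    mul_inv_cancel₀ (Finsupp.mem_support_iff.1 hj)
  have hn : ∀ i j k, 0 ≤ l i j * r j * h j k := fun i j k =>
    mul_nonneg (mul_nonneg (l0 i j) (r0 j)) (h0 j k)
  -- the two normalisation identities
  have eq1 : ∀ i, ∀ j ∈ B, ∑ k ∈ K, l i j * r j * h j k + l i j * r j * w j = l i j := by
    intro i j hj
    rw [← Finset.mul_sum, ← mul_add, hrow j hj, mul_assoc, mul_comm (r j), rE j hj, mul_one]
  have eq2 : ∀ k, ∀ j ∈ B, ∑ i ∈ A, l i j * r j * h j k + y j * r j * h j k = h j k := by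
    intro k j hj
    rw [← Finset.sum_mul, ← Finset.sum_mul, ← add_mul, ← add_mul, lcol j hj, rE j hj, one_mul]
  -- The plans are composed through each `j` in proportion to the mass of `E` there. Mass that the
  -- first plan brings to `j` and the second destroys is added to `x`; mass created at `j` by the
  -- first and moved on by the second is added to `z`.
  refine ⟨_, ⟨fun i k => ∑ j ∈ B, l i j * r j * h j k, fun i => x i + ∑ j ∈ B, l i j * r j * w j,
    fun k => z k + ∑ j ∈ B, y j * r j * h j k, ⟨fun i k => Finset.sum_nonneg fun j _ => hn i j k,
      fun i => add_nonneg (x0 i) (Finset.sum_nonneg fun j _ =>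
        mul_nonneg (mul_nonneg (l0 i j) (r0 j)) (w0 j)),
      fun k => add_nonneg (z0 k) (Finset.sum_nonneg fun j _ =>
        mul_nonneg (mul_nonneg (y0 j) (r0 j)) (h0 j k)), fun k hk => ?_, fun i hi => ?_⟩, rfl⟩, ?_⟩
  · rw [Finset.sum_comm, add_left_comm, ← Finset.sum_add_distrib, Finset.sum_congr rfl (eq2 k),
      add_comm, hcol k hk]
  · rw [Finset.sum_comm, add_left_comm, ← Finset.sum_add_distrib, Finset.sum_congr rfl (eq1 i),
      add_comm, lrow i hi]
  · unfold planCost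
    have b1 : ∑ i ∈ A, ∑ k ∈ K, (∑ j ∈ B, l i j * r j * h j k) * ρ i k ≤
        ∑ i ∈ A, ∑ j ∈ B, (∑ k ∈ K, l i j * r j * h j k) * μ i j +
          ∑ j ∈ B, ∑ k ∈ K, (∑ i ∈ A, l i j * r j * h j k) * ν j k := by
      calc _ ≤ ∑ i ∈ A, ∑ k ∈ K, ∑ j ∈ B, (l i j * r j * h j k * μ i j +
            l i j * r j * h j k * ν j k) := by
            refine Finset.sum_le_sum fun i _ => Finset.sum_le_sum fun k _ => ?_
            rw [Finset.sum_mul]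
            refine Finset.sum_le_sum fun j _ => ?_
            rw [← mul_add]
            exact mul_le_mul_of_nonneg_left (ht i j k) (hn i j k)
        _ = _ := by
            simp only [Finset.sum_add_distrib, Finset.sum_mul]
            congr 1
            · exact Finset.sum_congr rfl fun i _ => Finset.sum_comm
            · rw [Finset.sum_comm]
              rw [Finset.sum_congr rfl fun k _ => Finset.sum_comm]
              rw [Finset.sum_comm]
    have b2 : ∑ i ∈ A, ∑ j ∈ B, (∑ k ∈ K, l i j * r j * h j k) * μ i j ≤
        ∑ i ∈ A, ∑ j ∈ B, l i j * μ i j := by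
      refine Finset.sum_le_sum fun i _ => Finset.sum_le_sum fun j hj =>
        mul_le_mul_of_nonneg_right ?_ (hμ i j)
      have := mul_nonneg (mul_nonneg (l0 i j) (r0 j)) (w0 j)
      linarith [eq1 i j hj]
    have b3 : ∑ j ∈ B, ∑ k ∈ K, (∑ i ∈ A, l i j * r j * h j k) * ν j k ≤
        ∑ j ∈ B, ∑ k ∈ K, h j k * ν j k := by
      refine Finset.sum_le_sum fun j hj => Finset.sum_le_sum fun k _ =>
        mul_le_mul_of_nonneg_right ?_ (hν j k)
      have := mul_nonneg (mul_nonneg (y0 j) (r0 j)) (h0 j k)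
      linarith [eq2 k j hj]
    have b4 : ∑ i ∈ A, ∑ j ∈ B, l i j * r j * w j ≤ ∑ j ∈ B, w j := by
      rw [Finset.sum_comm]
      refine Finset.sum_le_sum fun j hj => ?_
      rw [← Finset.sum_mul, ← Finset.sum_mul]
      refine mul_le_of_le_one_left (w0 j) ?_
      rw [← rE j hj]
      exact mul_le_mul_of_nonneg_right (by linarith [lcol j hj, y0 j]) (r0 j)
    have b5 : ∑ k ∈ K, ∑ j ∈ B, y j * r j * h j k ≤ ∑ j ∈ B, y j := by
      rw [Finset.sum_comm]
      refine Finset.sum_le_sum fun j hj => ?_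
      rw [← Finset.mul_sum, mul_assoc]
      refine mul_le_of_le_one_right (y0 j) ?_
      rw [mul_comm, ← rE j hj]
      exact mul_le_mul_of_nonneg_right (by linarith [hrow j hj, w0 j]) (r0 j)
    simp only [Finset.sum_add_distrib]
    linarith

/-- The triangle inequality for the liftings of three functions. -/
theorem lift_triangle_of_le {μ ν ρ : S → S → ℝ} (hμ : ∀ s t, 0 ≤ μ s t) (hν : ∀ s t, 0 ≤ ν s t)
    (hρ : ∀ s t, 0 ≤ ρ s t) (ht : ∀ s u t, ρ s t ≤ μ s u + ν u t) (D E G : FinDistr S) :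
    lift ρ D G ≤ lift μ D E + lift ν E G := by
  have h1 : ∀ d ∈ planCosts ν E G, lift ρ D G - d ≤ lift μ D E := fun d hd =>
    le_csInf (planCosts_nonempty μ D E) fun c hc => by
      obtain ⟨e, he, hle⟩ := exists_plan_trans_of_le hμ hν ht D E G hc hd
      have : lift ρ D G ≤ c + d := (csInf_le (bddBelow_planCosts hρ D G) he).trans hle
      linarith
  have h2 : lift ρ D G - lift μ D E ≤ lift ν E G :=
    le_csInf (planCosts_nonempty ν E G) fun d hd => by linarith [h1 d hd]
  linarith

theorem support_dirac (s : S) : (FinDistr.dirac s).toFinsupp.support = {s} :=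
  Finsupp.support_single s one_ne_zero

theorem lift_dirac {μ : S → S → ℝ} (hμ : ∀ s t, 0 ≤ μ s t) (h1 : ∀ s t, μ s t ≤ 1) (s t : S) :
    lift μ (FinDistr.dirac s) (FinDistr.dirac t) = μ s t := by
  apply le_antisymm
  · refine lift_le_of_coupled hμ ((Coupled.single μ s t zero_le_one).mono ?_)
    rw [one_mul]
  · refine le_csInf (planCosts_nonempty _ _ _) ?_
    rintro _ ⟨h, w, z, hp, rfl⟩
    have hcol := hp.col t
    have hrow := hp.row s
    have := hp.w_nonneg s
    have := hp.z_nonneg t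
    have e : ∀ s : S, (FinDistr.dirac s).toFinsupp s = 1 := fun s => Finsupp.single_eq_same
    simp only [support_dirac, Finset.mem_singleton, Finset.sum_singleton, forall_const, planCost,
      e] at hcol hrow ⊢
    -- If `a` is the mass moved, then the cost is `a * μ s t + 2 * (1 - a)`, which exceeds `μ s t`
    -- by `(1 - a) * (2 - μ s t)`.
    nlinarith [h1 s t, hμ s t]

theorem map_toFinsupp {T : Type} (f : S ↪ T) (D : FinDistr S) :
    (D.map f).toFinsupp = D.toFinsupp.mapDomain f :=
  Finsupp.embDomain_eq_mapDomain f D.toFinsupp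

theorem Coupled.mapDomain {T : Type} (f : S → T) {μ : T → T → ℝ} {D E : S →₀ ℝ} {r : ℝ}
    (h : Coupled (fun s t => μ (f s) (f t)) D E r) :
    Coupled μ (D.mapDomain f) (E.mapDomain f) r := by
  obtain ⟨H, w, z, h1, h2, h3, rfl, rfl, h6⟩ := h
  refine ⟨H.mapDomain (Prod.map f f), w.mapDomain f, z.mapDomain f, Finsupp.mapDomain_nonneg h1,
    Finsupp.mapDomain_nonneg h2, Finsupp.mapDomain_nonneg h3, ?_, ?_, ?_⟩
  · rw [Finsupp.mapDomain_add, ← Finsupp.mapDomain_comp, ← Finsupp.mapDomain_comp]; rfl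
  · rw [Finsupp.mapDomain_add, ← Finsupp.mapDomain_comp, ← Finsupp.mapDomain_comp]; rfl
  · rw [weight_mapDomain, weight_mapDomain, Finsupp.linearCombination_mapDomain]; exact h6

/-- The lifting commutes with injections. -/
theorem lift_map {T : Type} (f : S ↪ T) {μ : T → T → ℝ} (hμ : ∀ s t, 0 ≤ μ s t)
    (D E : FinDistr S) :
    lift μ (D.map f) (E.map f) = lift (fun s t => μ (f s) (f t)) D E := by
  apply le_antisymm
  · refine le_of_forall_gt_imp_ge_of_dense fun r hr => lift_le_of_coupled hμ ?_
    rw [map_toFinsupp, map_toFinsupp]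
    exact (Coupled.of_lift_lt hr).mapDomain f
  -- The supports of the images are the images of the supports, so a plan restricts along `f` at the
  -- same cost.
  · refine le_csInf (planCosts_nonempty _ _ _) ?_
    rintro _ ⟨h, w, z, hp, rfl⟩
    have hs : ∀ D : FinDistr S, (D.map f).toFinsupp.support = D.toFinsupp.support.map f :=
      fun D => Finsupp.support_embDomain f D.toFinsupp
    have ha : ∀ (D : FinDistr S) (s : S), (D.map f).toFinsupp (f s) = D.toFinsupp s :=
      fun D s => Finsupp.embDomain_apply_self f D.toFinsupp s
    have hcol := hp.col
    have hrow := hp.row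
    simp only [hs, Finset.forall_mem_map, Finset.sum_map, ha] at hcol hrow
    refine csInf_le (bddBelow_planCosts (fun s t => hμ _ _) D E)
      ⟨fun s t => h (f s) (f t), fun s => w (f s), fun t => z (f t),
        ⟨fun s t => hp.h_nonneg _ _, fun s => hp.w_nonneg _, fun t => hp.z_nonneg _,
          hcol, hrow⟩, ?_⟩
    simp only [planCost, hs, Finset.sum_map]

end

/-! ### Semantics of composite programs -/

theorem FinDistr.ext_toFinsupp {S : Type} {D E : FinDistr S} (h : D.toFinsupp = E.toFinsupp) :
    D = E := by
  cases D; cases E; cases h; rfl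

theorem Program.bigStep_sem (M : Program) : BigStep M.1 M.sem.toFinsupp :=
  (M.bigStep_iff _).2 rfl

theorem Program.sem_eq {M : Program} {D : Value →₀ ℝ} (h : BigStep M.1 D) :
    M.sem.toFinsupp = D := ((M.bigStep_iff D).1 h).symm

theorem Value.sem_toProgram (V : Value) : V.toProgram.sem = FinDistr.dirac V :=
  FinDistr.ext_toFinsupp (Program.sem_eq (.value V.affine))

/-! ### Properties of the bisimulation distance -/

theorem lift_trans_le_bisimMetric {S L : Type} (K : LMC S L) (s t : S) (a : L) :
    lift (bisimMetric K).dist (K.trans s a) (K.trans t a) ≤ (bisimMetric K).dist s t := by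
  have h : bisimOperator K (bisimMetric K) = bisimMetric K := OrderHom.map_gfp _
  have hd : (bisimMetric K).dist s t =
      ⨆ a : L, lift (bisimMetric K).dist (K.trans s a) (K.trans t a) :=
    congrArg (fun μ => μ.dist s t) h.symm
  rw [hd]
  exact le_ciSup (f := fun a => lift (bisimMetric K).dist (K.trans s a) (K.trans t a))
    ⟨1, by rintro _ ⟨a, rfl⟩; exact lift_le_one (bisimMetric K).nonneg (bisimMetric K).le_one _ _⟩ a

theorem bisimMetric_le {S L : Type} (K : LMC S L) {s t : S} {r : ℝ} (hr : 0 ≤ r)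
    (h : ∀ a, lift (bisimMetric K).dist (K.trans s a) (K.trans t a) ≤ r) :
    (bisimMetric K).dist s t ≤ r := by
  have hf : bisimOperator K (bisimMetric K) = bisimMetric K := OrderHom.map_gfp _
  rw [← hf]
  exact Real.iSup_le h hr

theorem FinDistr.map_dirac {S T : Type} (f : S ↪ T) (s : S) :
    (dirac s).map f = dirac (f s) :=
  ext_toFinsupp (Finsupp.embDomain_single f s 1)

theorem trans_toProgram_eval (V : Value) :
    lambdaLMC.trans (.prog V.toProgram) .eval = FinDistr.dirac (.dval V) := by
  change V.toProgram.sem.map dvalEmb = _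
  rw [V.sem_toProgram, FinDistr.map_dirac]
  rfl

/-- The only nonempty transition of a value taken as a program leads to its distinguished copy with
probability one. Together with the converse inequality below, this identifies distances between
values with distances between their copies. -/
theorem bisimDistance_toProgram_le (V W : Value) :
    bisimDistance.dist V.toProgram W.toProgram ≤
      (bisimMetric lambdaLMC).dist (.dval V) (.dval W) := by
  refine bisimMetric_le _ ((bisimMetric lambdaLMC).nonneg _ _) fun a => ?_
  cases a with
  | eval =>
    rw [trans_toProgram_eval, trans_toProgram_eval,
      lift_dirac (Pseudometric.nonneg _) (Pseudometric.le_one _)]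
  | pass U =>
    exact (lift_self (Pseudometric.nonneg _) (Pseudometric.dist_self _) _).trans_le
      (Pseudometric.nonneg _ _ _)

theorem le_bisimDistance_toProgram (V W : Value) :
    (bisimMetric lambdaLMC).dist (.dval V) (.dval W) ≤
      bisimDistance.dist V.toProgram W.toProgram := by
  have := lift_trans_le_bisimMetric lambdaLMC (.prog V.toProgram) (.prog W.toProgram) .eval
  rwa [trans_toProgram_eval, trans_toProgram_eval,
    lift_dirac (Pseudometric.nonneg _) (Pseudometric.le_one _)] at this

theorem bisimDistance_beta_le (V W U : Value) :
    bisimDistance.dist (V.beta U) (W.beta U) ≤ bisimDistance.dist V.toProgram W.toProgram := by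
  have := lift_trans_le_bisimMetric lambdaLMC (.dval V) (.dval W) (.pass U)
  change lift _ (FinDistr.dirac _) (FinDistr.dirac _) ≤ _ at this
  rw [lift_dirac (Pseudometric.nonneg _) (Pseudometric.le_one _)] at this
  exact this.trans (le_bisimDistance_toProgram V W)

theorem lift_sem_le_bisimDistance (M N : Program) :
    lift (fun V W => bisimDistance.dist V.toProgram W.toProgram) M.sem N.sem ≤
      bisimDistance.dist M N := by
  have := lift_trans_le_bisimMetric lambdaLMC (.prog M) (.prog N) .eval
  change lift _ (M.sem.map dvalEmb) (N.sem.map dvalEmb) ≤ _ at this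
  rw [lift_map _ (Pseudometric.nonneg _)] at this
  exact (lift_mono (fun V W => bisimDistance.nonneg _ _) bisimDistance_toProgram_le _ _).trans this

/-! ### The quantitative Howe lifting -/

/-- `Howe Γ ε M N`: the term `N` is obtained from `M` by compatible closure and by moving closed
subterms along the bisimulation distance, at total cost at most `ε`. -/
inductive Howe : Finset ℕ → ℝ → Term → Term → Prop
  | var {Γ : Finset ℕ} {ε : ℝ} {x : ℕ} (hε : 0 ≤ ε) (hx : x ∈ Γ) :
      Howe Γ ε (.var x) (.var x)
  | lam {Γ : Finset ℕ} {ε : ℝ} {x : ℕ} {M N : Term} (h : Howe (insert x Γ) ε M N) :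
      Howe Γ ε (.lam x M) (.lam x N)
  | app {Γ Δ : Finset ℕ} {ε ε' : ℝ} {M M' N N' : Term} (hd : Disjoint Γ Δ)
      (hM : Howe Γ ε M M') (hN : Howe Δ ε' N N') :
      Howe (Γ ∪ Δ) (ε + ε') (.app M N) (.app M' N')
  | choice {Γ : Finset ℕ} {ε : ℝ} {M M' N N' : Term}
      (hM : Howe Γ ε M M') (hN : Howe Γ ε N N') : Howe Γ ε (.choice M N) (.choice M' N')
  | omega {Γ : Finset ℕ} {ε : ℝ} (hε : 0 ≤ ε) : Howe Γ ε .omega .omega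
  | trans {Γ : Finset ℕ} {ε ε' : ℝ} {M : Term} (P N : Program) (h : Howe ∅ ε M P.1)
      (hd : bisimDistance.dist P N ≤ ε') : Howe Γ (ε + ε') M N.1

namespace Howe

variable {Γ Δ : Finset ℕ} {ε ε' : ℝ} {M N : Term}

theorem nonneg (h : Howe Γ ε M N) : 0 ≤ ε := by
  induction h with
  | var hε _ => exact hε
  | lam _ ih => exact ih
  | app _ _ _ ih₁ ih₂ => exact add_nonneg ih₁ ih₂
  | choice _ _ ih _ => exact ih
  | omega hε => exact hε
  | trans P N _ hd ih => exact add_nonneg ih ((bisimDistance.nonneg P N).trans hd)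

theorem mono (h : Howe Γ ε M N) : ∀ {ε' : ℝ}, ε ≤ ε' → Howe Γ ε' M N := by
  induction h with
  | var hε hx => exact fun hle => .var (hε.trans hle) hx
  | lam _ ih => exact fun hle => .lam (ih hle)
  | @app Γ Δ e e' _ _ _ _ hd hM _ _ ih =>
    intro ε' hle
    -- All of the extra cost is given to the argument.
    have := Howe.app hd hM (ih (show e' ≤ ε' - e by linarith))
    rwa [add_sub_cancel] at this
  | choice _ _ ih₁ ih₂ => exact fun hle => .choice (ih₁ hle) (ih₂ hle)
  | omega hε => exact fun hle => .omega (hε.trans hle)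
  | @trans Γ e e' _ P N h hd _ =>
    intro ε' hle
    have := Howe.trans (Γ := Γ) P N h (hd.trans (show e' ≤ ε' - e by linarith))
    rwa [add_sub_cancel] at this

theorem affine_left (h : Howe Γ ε M N) : Affine Γ M := by
  induction h with
  | var _ hx => exact .var hx
  | lam _ ih => exact .lam ih
  | app hd _ _ ih₁ ih₂ => exact .app hd ih₁ ih₂
  | choice _ _ ih₁ ih₂ => exact .choice ih₁ ih₂
  | omega _ => exact .omega
  | trans _ _ _ _ ih => exact ih.weaken (Finset.empty_subset _)

theorem affine_right (h : Howe Γ ε M N) : Affine Γ N := by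
  induction h with
  | var _ hx => exact .var hx
  | lam _ ih => exact .lam ih
  | app hd _ _ ih₁ ih₂ => exact .app hd ih₁ ih₂
  | choice _ _ ih₁ ih₂ => exact .choice ih₁ ih₂
  | omega _ => exact .omega
  | trans _ N _ _ _ => exact N.2.weaken (Finset.empty_subset _)

theorem refl (h : Affine Γ M) : Howe Γ 0 M M := by
  induction h with
  | var hx => exact .var le_rfl hx
  | lam _ ih => exact .lam ih
  | app hd _ _ ih₁ ih₂ => simpa using Howe.app hd ih₁ ih₂
  | choice _ _ ih₁ ih₂ => exact .choice ih₁ ih₂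
  | omega => exact .omega le_rfl

theorem of_bisimDistance_le {M N : Program} (h : bisimDistance.dist M N ≤ ε) :
    Howe Γ ε M.1 N.1 := by
  simpa using Howe.trans (Γ := Γ) M N (refl M.2) h

theorem weaken (h : Howe Γ ε M N) : ∀ {Δ : Finset ℕ}, Γ ⊆ Δ → Howe Δ ε M N := by
  induction h with
  | var hε hx => exact fun hs => .var hε (hs hx)
  | lam _ ih => exact fun hs => .lam (ih (Finset.insert_subset_insert _ hs))
  | @app Γ₁ Γ₂ e e' _ _ _ _ hd _ _ ih₁ ih₂ =>
    intro Δ hs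
    have h1 : Γ₁ ⊆ Δ := Finset.union_subset_left hs
    have h2 : Γ₂ ⊆ Δ \ Γ₁ :=
      Finset.subset_sdiff.2 ⟨Finset.union_subset_right hs, hd.symm⟩
    have := Howe.app Finset.disjoint_sdiff (ih₁ (Finset.Subset.refl Γ₁)) (ih₂ h2)
    rwa [Finset.union_sdiff_of_subset h1] at this
  | choice _ _ ih₁ ih₂ => exact fun hs => .choice (ih₁ hs) (ih₂ hs)
  | omega hε => exact fun _ => .omega hε
  | trans P N h hd _ => exact fun _ => .trans P N h hd

end Howe

/-! ### Substitution and inversion for the Howe lifting -/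

theorem Affine.subst_of_notMem {Γ : Finset ℕ} {M : Term} (h : Affine Γ M) {x : ℕ} (V : Term) :
    x ∉ Γ → M.subst x V = M := by
  induction h with
  | var hy =>
    intro hx
    simp only [Term.subst]
    rw [if_neg]
    rintro rfl
    exact hx hy
  | @lam Γ y M _ ih =>
    intro hx
    simp only [Term.subst]
    split_ifs with hyx
    · rfl
    · rw [ih]
      simp [hx, Ne.symm hyx]
  | app _ _ _ ih₁ ih₂ =>
    intro hx
    rw [Finset.mem_union, not_or] at hx
    rw [Term.subst, ih₁ hx.1, ih₂ hx.2]
  | choice _ _ ih₁ ih₂ => intro hx; rw [Term.subst, ih₁ hx, ih₂ hx]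
  | omega => intro _; rfl

namespace Howe

variable {Γ Δ : Finset ℕ} {ε ε' : ℝ} {M N : Term}

/-- The cost `ε'` is charged only when `x` is available in `Γ`. This keeps the induction additive:
in an application `x` belongs to at most one of the two disjoint contexts. -/
theorem subst {U U' : Term} {x : ℕ} (h : Howe Γ ε M N) (hU : Howe ∅ ε' U U') :
    Howe (Γ.erase x) (ε + if x ∈ Γ then ε' else 0) (M.subst x U) (N.subst x U') := by
  have h0 : ∀ Γ : Finset ℕ, 0 ≤ if x ∈ Γ then ε' else 0 := fun Γ => by
    split_ifs
    exacts [hU.nonneg, le_rfl]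
  induction h with
  | @var Γ e y he hy =>
    simp only [Term.subst]
    by_cases hyx : y = x
    · subst hyx
      rw [if_pos rfl, if_pos rfl, if_pos hy]
      exact (hU.weaken (Finset.empty_subset _)).mono (le_add_of_nonneg_left he)
    · rw [if_neg hyx, if_neg hyx]
      exact .var (add_nonneg he (h0 Γ)) (Finset.mem_erase.2 ⟨hyx, hy⟩)
  | @lam Γ e y M N hM ih =>
    simp only [Term.subst]
    by_cases hyx : y = x
    · subst hyx
      rw [if_pos rfl, if_pos rfl]
      -- The binder shadows `x`, so nothing is substituted and the charge is mere slack.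
      refine .lam ((hM.mono (le_add_of_nonneg_right (h0 Γ))).weaken ?_)
      intro z; simp only [Finset.mem_insert, Finset.mem_erase]; tauto
    · rw [if_neg hyx, if_neg hyx]
      have : (x ∈ insert y Γ) ↔ x ∈ Γ := by
        rw [Finset.mem_insert]; exact or_iff_right (fun h => hyx h.symm)
      simp only [this] at ih
      refine .lam (ih.weaken ?_)
      intro z; simp only [Finset.mem_insert, Finset.mem_erase]; tauto
  | @app Γ Δ e e' _ _ _ _ hd _ _ ih₁ ih₂ =>
    rw [Finset.erase_union_distrib]
    refine (Howe.app (hd.mono (Finset.erase_subset _ _) (Finset.erase_subset _ _)) ih₁ ih₂).mono ?_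
    have hn : ¬ (x ∈ Γ ∧ x ∈ Δ) := fun h => Finset.disjoint_left.1 hd h.1 h.2
    have := hU.nonneg
    by_cases h1 : x ∈ Γ <;> by_cases h2 : x ∈ Δ <;> simp [h1, h2] at hn ⊢ <;> linarith
  | choice _ _ ih₁ ih₂ => exact .choice ih₁ ih₂
  | @omega Γ e he => exact .omega (add_nonneg he (h0 Γ))
  | @trans Γ e e' M P N h hd _ =>
    -- A `trans` step relates closed terms, which substitution leaves alone.
    rw [h.affine_left.subst_of_notMem U (Finset.notMem_empty x),
      N.2.subst_of_notMem U' (Finset.notMem_empty x)]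
    exact (Howe.trans P N h hd).mono (le_add_of_nonneg_right (h0 Γ))

theorem subst_body {x : ℕ} {U U' : Term} (h : Howe {x} ε M N) (hU : Howe ∅ ε' U U') :
    Howe ∅ (ε + ε') (M.subst x U) (N.subst x U') := by
  simpa using h.subst (x := x) hU

/-- A derivation is one compatible rule followed by a chain of `trans` steps. The triangle
inequality merges the chain into a single distance, which accounts for the rest `ε - e` of the cost.
The other inversion lemmas follow the same pattern. -/
theorem lam_inv {x : ℕ} {N : Program} (h : Howe ∅ ε (.lam x M) N.1) :
    ∃ (e : ℝ) (W : Value), W.x = x ∧ Howe {x} e M W.body ∧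
      bisimDistance.dist W.toProgram N ≤ ε - e := by
  suffices key : ∀ {Γ : Finset ℕ} {ε : ℝ} {T N : Term}, Howe Γ ε T N →
      ∀ hN : Affine ∅ N, .lam x M = T → ∅ = Γ →
        ∃ (e : ℝ) (W : Value), W.x = x ∧ Howe {x} e M W.body ∧
        bisimDistance.dist W.toProgram ⟨N, hN⟩ ≤ ε - e from
    key h N.2 rfl rfl
  intro Γ ε T N h
  induction h with
  | lam h _ =>
    intro hN hT hΓ
    cases hT; subst hΓ
    exact ⟨_, ⟨x, _, h.affine_right⟩, rfl, h, by
      rw [sub_self]; exact (bisimDistance.dist_self _).le⟩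
  | trans P N h hd ih =>
    intro hN hT hΓ
    obtain ⟨e, W, hx, hW, hle⟩ := ih P.2 hT rfl
    exact ⟨e, W, hx, hW, (bisimDistance.triangle _ _ P).trans
      ((add_le_add hle hd).trans_eq (by ring))⟩
  | _ => intro _ hT; cases hT

theorem omega_inv {N : Program} (h : Howe ∅ ε .omega N.1) :
    bisimDistance.dist ⟨.omega, .omega⟩ N ≤ ε := by
  suffices key : ∀ {Γ : Finset ℕ} {ε : ℝ} {T N : Term}, Howe Γ ε T N →
      ∀ hN : Affine ∅ N, .omega = T → ∅ = Γ →
        bisimDistance.dist ⟨.omega, .omega⟩ ⟨N, hN⟩ ≤ ε from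
    key h N.2 rfl rfl
  intro Γ ε T N h
  induction h with
  | omega hε => intro _ _ _; exact (bisimDistance.dist_self _).trans_le hε
  | trans P N h hd ih =>
    intro _ hT _
    exact (bisimDistance.triangle _ _ P).trans (add_le_add (ih P.2 hT rfl) hd)
  | _ => intro _ hT; cases hT

theorem choice_inv {L : Term} {N : Program} (h : Howe ∅ ε (.choice M L) N.1) :
    ∃ (e : ℝ) (P Q : Program), Howe ∅ e M P.1 ∧ Howe ∅ e L Q.1 ∧
      bisimDistance.dist ⟨.choice P.1 Q.1, .choice P.2 Q.2⟩ N ≤ ε - e := by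
  suffices key : ∀ {Γ : Finset ℕ} {ε : ℝ} {T N : Term}, Howe Γ ε T N →
      ∀ hN : Affine ∅ N, .choice M L = T → ∅ = Γ →
        ∃ (e : ℝ) (P Q : Program), Howe ∅ e M P.1 ∧ Howe ∅ e L Q.1 ∧
        bisimDistance.dist ⟨.choice P.1 Q.1, .choice P.2 Q.2⟩ ⟨N, hN⟩ ≤ ε - e from
    key h N.2 rfl rfl
  intro Γ ε T N h
  induction h with
  | choice h₁ h₂ =>
    intro hN hT hΓ
    cases hT; subst hΓ
    exact ⟨_, ⟨_, h₁.affine_right⟩, ⟨_, h₂.affine_right⟩, h₁, h₂, by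
      rw [sub_self]; exact (bisimDistance.dist_self _).le⟩
  | trans P N h hd ih =>
    intro hN hT hΓ
    obtain ⟨e, R, Q, hR, hQ, hle⟩ := ih P.2 hT rfl
    exact ⟨e, R, Q, hR, hQ, (bisimDistance.triangle _ _ P).trans
      ((add_le_add hle hd).trans_eq (by ring))⟩
  | _ => intro _ hT; cases hT

end Howe

/-- The application of two programs. -/
def Program.app (P Q : Program) : Program :=
  ⟨.app P.1 Q.1, by simpa using Affine.app (Finset.disjoint_empty_left _) P.2 Q.2⟩

namespace Howe

variable {Γ Δ : Finset ℕ} {ε ε' : ℝ} {M N : Term}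

theorem app_inv {L : Term} {N : Program} (h : Howe ∅ ε (.app M L) N.1) :
    ∃ (e e' : ℝ) (P Q : Program), Howe ∅ e M P.1 ∧ Howe ∅ e' L Q.1 ∧
      bisimDistance.dist (P.app Q) N ≤ ε - (e + e') := by
  suffices key : ∀ {Γ : Finset ℕ} {ε : ℝ} {T N : Term}, Howe Γ ε T N →
      ∀ hN : Affine ∅ N, .app M L = T → ∅ = Γ →
        ∃ (e e' : ℝ) (P Q : Program), Howe ∅ e M P.1 ∧ Howe ∅ e' L Q.1 ∧
        bisimDistance.dist (P.app Q) ⟨N, hN⟩ ≤ ε - (e + e') from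
    key h N.2 rfl rfl
  intro Γ ε T N h
  induction h with
  | app _ h₁ h₂ =>
    intro hN hT hΓ
    cases hT
    obtain ⟨rfl, rfl⟩ := Finset.union_eq_empty.1 hΓ.symm
    exact ⟨_, _, ⟨_, h₁.affine_right⟩, ⟨_, h₂.affine_right⟩, h₁, h₂, by
      rw [sub_self]; exact (bisimDistance.dist_self _).le⟩
  | trans P N h hd ih =>
    intro hN hT hΓ
    obtain ⟨e, e', R, Q, hR, hQ, hle⟩ := ih P.2 hT rfl
    exact ⟨e, e', R, Q, hR, hQ, (bisimDistance.triangle _ _ P).trans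
      ((add_le_add hle hd).trans_eq (by ring))⟩
  | _ => intro _ hT; cases hT

end Howe

/-- The least cost of the Howe lifting between two values. -/
noncomputable def howeCost (V W : Value) : ℝ := sInf {ε | Howe ∅ ε V.toTerm W.toTerm}

theorem howe_set_nonempty (V W : Value) : {ε | Howe ∅ ε V.toTerm W.toTerm}.Nonempty :=
  ⟨_, Howe.of_bisimDistance_le (M := V.toProgram) (N := W.toProgram) le_rfl⟩

theorem howeCost_nonneg (V W : Value) : 0 ≤ howeCost V W :=
  Real.sInf_nonneg fun _ h => Howe.nonneg h

theorem howeCost_le {V W : Value} {ε : ℝ} (h : Howe ∅ ε V.toTerm W.toTerm) : howeCost V W ≤ ε :=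
  csInf_le ⟨0, fun _ h => Howe.nonneg h⟩ h

theorem howeCost_le_one (V W : Value) : howeCost V W ≤ 1 :=
  howeCost_le (Howe.of_bisimDistance_le (M := V.toProgram) (N := W.toProgram)
    (bisimDistance.le_one _ _))

theorem Howe.of_howeCost_lt {V W : Value} {ε : ℝ} (h : howeCost V W < ε) :
    Howe ∅ ε V.toTerm W.toTerm := by
  obtain ⟨e, he, hlt⟩ := exists_lt_of_csInf_lt (howe_set_nonempty V W) h
  exact Howe.mono he hlt.le

theorem howeCost_le_add (V U W : Value) :
    howeCost V W ≤ howeCost V U + bisimDistance.dist U.toProgram W.toProgram := by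
  rw [← sub_le_iff_le_add]
  refine le_csInf (howe_set_nonempty V U) fun e he => ?_
  rw [sub_le_iff_le_add]
  exact howeCost_le (Howe.trans U.toProgram W.toProgram he le_rfl)

/-- Absorbs the final distance produced by the inversion lemmas, so that only the compatible rule
needs treatment in the induction on evaluation. -/
theorem lift_howeCost_le_add {M P N : Program} {e e' : ℝ} (h : lift howeCost M.sem P.sem ≤ e)
    (h' : bisimDistance.dist P N ≤ e') : lift howeCost M.sem N.sem ≤ e + e' :=
  (lift_triangle_of_le howeCost_nonneg (fun _ _ => bisimDistance.nonneg _ _) howeCost_nonneg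
    howeCost_le_add _ P.sem _).trans
    (add_le_add h ((lift_sem_le_bisimDistance P N).trans h'))

/-- Related functions yield related results on related arguments. -/
theorem Howe.beta {V W U U' : Value} {ε ε' : ℝ} (h : Howe ∅ ε V.toTerm W.toTerm)
    (hU : Howe ∅ ε' U.toTerm U'.toTerm) : Howe ∅ (ε + ε') (V.beta U).1 (W.beta U').1 := by
  obtain ⟨x, M, hM⟩ := V
  -- The bodies of `V` and `R` are related at cost `e`. Substitution adds `ε'`, and passing `U'` to
  -- `R` and `W` preserves their distance, at most `ε - e`; the `e` cancels.
  obtain ⟨e, R, rfl, hR, hle⟩ := Howe.lam_inv (N := W.toProgram) h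
  have := Howe.trans (Γ := ∅) (R.beta U') (W.beta U') (hR.subst_body hU)
    ((bisimDistance_beta_le R W U').trans hle)
  refine this.mono ?_
  linarith

/-! ### Evaluation of related programs -/

theorem sem_nonneg (M : Program) : 0 ≤ M.sem.toFinsupp := M.sem.nonneg

theorem Program.sem_app (P Q : Program) :
    (P.app Q).sem.toFinsupp = Finsupp.linearCombination ℝ (fun W =>
      Finsupp.linearCombination ℝ (fun V => (W.beta V).sem.toFinsupp) Q.sem.toFinsupp)
      P.sem.toFinsupp := by
  rw [Program.sem_eq (.app P.bigStep_sem Q.bigStep_sem fun W _ V _ => (W.beta V).bigStep_sem)]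
  simp only [Finsupp.linearCombination_apply, Finsupp.smul_sum, smul_smul]

/-- The semantics of an application is an iterated push-forward, so `Coupled.bind` is used twice,
first over functions and then over arguments. The premise `hβ` covers only left values in the
supports, where the induction hypothesis on evaluation will be available. -/
theorem coupled_sem_app {P Q P' Q' : Program} {e e' k : ℝ}
    (h₁ : Coupled howeCost P.sem.toFinsupp P'.sem.toFinsupp e)
    (h₂ : Coupled howeCost Q.sem.toFinsupp Q'.sem.toFinsupp e') (hk : 0 ≤ k) (he' : 0 ≤ e')
    (hβ : ∀ W ∈ P.sem.toFinsupp.support, ∀ V ∈ Q.sem.toFinsupp.support, ∀ W' V',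
      Coupled howeCost (W.beta V).sem.toFinsupp (W'.beta V').sem.toFinsupp
        (howeCost W W' + howeCost V V' + k)) :
    Coupled howeCost (P.app Q).sem.toFinsupp (P'.app Q').sem.toFinsupp (e + (e' + k)) := by
  have n : ∀ (Q : Program) (W : Value), 0 ≤ Finsupp.linearCombination ℝ
      (fun V => (W.beta V).sem.toFinsupp) Q.sem.toFinsupp := fun Q W =>
    linearCombination_nonneg (fun V => sem_nonneg _) (sem_nonneg Q)
  have o : ∀ (Q : Program) (W : Value), weight Value (Finsupp.linearCombination ℝ
      (fun V => (W.beta V).sem.toFinsupp) Q.sem.toFinsupp) ≤ 1 := fun Q W =>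
    (weight_linearCombination_le (fun V => FinDistr.weight_le_one _) (sem_nonneg Q)).trans
      (FinDistr.weight_le_one _)
  rw [Program.sem_app, Program.sem_app]
  refine h₁.bind (FinDistr.weight_le_one _) (add_nonneg he' hk) (n Q) (n Q') (o Q) (o Q')
    fun W hW W' => ?_
  -- With the two functions fixed, their cost is a constant for the coupling of the arguments.
  refine (h₂.bind (k := howeCost W W' + k) (FinDistr.weight_le_one _)
    (add_nonneg (howeCost_nonneg _ _) hk) (fun _ => sem_nonneg _) (fun _ => sem_nonneg _)
    (fun _ => FinDistr.weight_le_one _) (fun _ => FinDistr.weight_le_one _)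
    fun V hV V' => ?_).mono (by linarith)
  exact (hβ W hW V hV W' V').mono (by linarith)

/-- The Howe lifting is preserved by evaluation. -/
theorem BigStep.lift_howeCost_le {M : Term} {D : Value →₀ ℝ} (h : BigStep M D) :
    ∀ (hM : Affine ∅ M) (N : Program) {ε : ℝ}, Howe ∅ ε M N.1 →
      lift howeCost (Program.sem ⟨M, hM⟩) N.sem ≤ ε := by
  induction h with
  | omega =>
    intro hM N ε hR
    have := lift_howeCost_le_add (M := ⟨.omega, hM⟩) (P := ⟨.omega, hM⟩) (e := 0) ?_ hR.omega_inv
    · simpa using this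
    · have hs : Program.sem ⟨.omega, hM⟩ = FinDistr.empty _ :=
        FinDistr.ext_toFinsupp (Program.sem_eq .omega)
      rw [hs]
      refine lift_le_of_coupled howeCost_nonneg ?_
      exact (Coupled.create le_rfl).mono (map_zero _).le
  | @value x M h =>
    intro hM N ε hR
    obtain ⟨e, W, rfl, hW, hle⟩ := hR.lam_inv
    have := lift_howeCost_le_add (M := ⟨.lam W.x M, hM⟩) (P := W.toProgram) (e := e) ?_ hle
    · simpa using this
    · have hs : Program.sem ⟨.lam W.x M, hM⟩ = FinDistr.dirac ⟨W.x, M, h⟩ :=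
        Value.sem_toProgram ⟨W.x, M, h⟩
      rw [hs, W.sem_toProgram, lift_dirac howeCost_nonneg howeCost_le_one]
      exact howeCost_le (.lam (by simpa using hW))
  | @choice M N D E _ _ ih₁ ih₂ =>
    intro hM' K ε hR
    obtain ⟨hM, hN⟩ := hM'.choice_inv
    obtain ⟨e, P, Q, hP, hQ, hle⟩ := hR.choice_inv
    have := lift_howeCost_le_add (M := ⟨.choice M N, hM'⟩) (e := e) ?_ hle
    · simpa using this
    · have hs : ∀ (M N : Program) (h : Affine ∅ (.choice M.1 N.1)),
          (Program.sem ⟨.choice M.1 N.1, h⟩).toFinsupp =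
            (1 / 2 : ℝ) • M.sem.toFinsupp + (1 / 2 : ℝ) • N.sem.toFinsupp := fun M N h =>
        Program.sem_eq (.choice M.bigStep_sem N.bigStep_sem)
      refine le_of_forall_gt_imp_ge_of_dense fun r hr => lift_le_of_coupled howeCost_nonneg ?_
      rw [hs ⟨M, hM⟩ ⟨N, hN⟩, hs P Q]
      have h₁ := Coupled.of_lift_lt ((ih₁ hM P hP).trans_lt hr)
      have h₂ := Coupled.of_lift_lt ((ih₂ hN Q hQ).trans_lt hr)
      exact ((h₁.smul (by norm_num)).add (h₂.smul (by norm_num))).mono (by linarith)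
  | @app M N D E F hMD hNE _ ih₁ ih₂ ih₃ =>
    intro hM' K ε hR
    obtain ⟨hM, hN⟩ := hM'.app_inv
    obtain ⟨e, e', P, Q, hP, hQ, hle⟩ := hR.app_inv
    have := lift_howeCost_le_add (M := ⟨.app M N, hM'⟩) (e := e + e') ?_ hle
    · simpa using this
    -- Infima are only approximated: `η / 3` each is spent on the functions, on the arguments and on
    -- the results. Within the last third, two slacks of `η / 12` realise the Howe costs of `W, W'`
    -- and `V, V'`, and the remainder gives a strict inequality.
    · refine le_of_forall_pos_le_add fun η hη => lift_le_of_coupled howeCost_nonneg ?_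
      have h₁ := Coupled.of_lift_lt ((ih₁ hM P hP).trans_lt (show e < e + η / 3 by linarith))
      have h₂ := Coupled.of_lift_lt ((ih₂ hN Q hQ).trans_lt (show e' < e' + η / 3 by linarith))
      refine (coupled_sem_app (P := ⟨M, hM⟩) (Q := ⟨N, hN⟩) (k := η / 3) h₁ h₂ (by linarith)
        (by linarith [hQ.nonneg]) fun W hW V hV W' V' => ?_).mono (by linarith)
      rw [Program.sem_eq (M := ⟨M, hM⟩) hMD] at hW
      rw [Program.sem_eq (M := ⟨N, hN⟩) hNE] at hV
      refine Coupled.of_lift_lt ((ih₃ W hW V hV (W.affine_beta V) (W'.beta V')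
        (ε := howeCost W W' + η / 12 + (howeCost V V' + η / 12))
        (Howe.beta (Howe.of_howeCost_lt ?_) (Howe.of_howeCost_lt ?_))).trans_lt ?_) <;> linarith

theorem Howe.lift_sem_le {M N : Program} {ε : ℝ} (h : Howe ∅ ε M.1 N.1) :
    lift howeCost M.sem N.sem ≤ ε :=
  M.bigStep_sem.lift_howeCost_le M.2 N h

/-! ### Non-expansiveness -/

/-- The pseudometrics that are bounded by the Howe lifting. -/
def howeBounded : Set (Pseudometric State) :=
  {μ | (∀ (M N : Program) (ε : ℝ), Howe ∅ ε M.1 N.1 → μ.dist (.prog M) (.prog N) ≤ ε) ∧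
    ∀ (V W : Value) (ε : ℝ), Howe ∅ ε V.toTerm W.toTerm → μ.dist (.dval V) (.dval W) ≤ ε}

/-- Infima in the reversed order are pointwise suprema, which keep upper bounds. -/
theorem sInf_howeBounded_mem : sInf howeBounded ∈ howeBounded :=
  ⟨fun M N ε h => Real.iSup_le (fun μ => μ.2.1 M N ε h) h.nonneg,
    fun V W ε h => Real.iSup_le (fun μ => μ.2.2 V W ε h) h.nonneg⟩

theorem bisimOperator_mem_howeBounded {μ : Pseudometric State} (hμ : μ ∈ howeBounded) :
    bisimOperator lambdaLMC μ ∈ howeBounded := by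
  refine ⟨fun M N ε h => Real.iSup_le (fun a => ?_) h.nonneg,
    fun V W ε h => Real.iSup_le (fun a => ?_) h.nonneg⟩
  · cases a with
    | eval =>
      change lift _ (M.sem.map dvalEmb) (N.sem.map dvalEmb) ≤ _
      rw [lift_map _ μ.nonneg]
      -- On distinguished values `μ` is below every Howe cost, hence below their infimum `howeCost`.
      exact (lift_mono (fun _ _ => μ.nonneg _ _) (fun V W =>
        le_csInf (howe_set_nonempty V W) fun e he => hμ.2 V W e he) _ _).trans h.lift_sem_le
    | pass U => exact (lift_self μ.nonneg μ.dist_self _).trans_le h.nonneg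
  · cases a with
    | eval => exact (lift_self μ.nonneg μ.dist_self _).trans_le h.nonneg
    | pass U =>
      change lift _ (FinDistr.dirac _) (FinDistr.dirac _) ≤ _
      rw [lift_dirac μ.nonneg μ.le_one]
      -- Both values receive the same argument, related to itself at cost zero.
      exact hμ.1 _ _ _ (by simpa using h.beta (Howe.refl U.affine_toTerm))

/-- Coinduction: the image of `sInf howeBounded` is again in `howeBounded`, so the infimum lies
below its image and hence below the greatest fixpoint. -/
theorem Howe.bisimDistance_le {M N : Program} {ε : ℝ} (h : Howe ∅ ε M.1 N.1) :
    bisimDistance.dist M N ≤ ε := by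
  have hle : sInf howeBounded ≤ bisimMetric lambdaLMC :=
    OrderHom.le_gfp _ (sInf_le (bisimOperator_mem_howeBounded sInf_howeBounded_mem))
  exact (hle (.prog M) (.prog N)).trans (sInf_howeBounded_mem.1 M N ε h)

/-- Only the hole costs anything. An application has a context on one side only, and the branches of
a choice share one cost, so the total never grows. -/
theorem AffineCtx.howe_fill {Γ : Finset ℕ} {C : Ctx} (h : AffineCtx Γ C) (M N : Program) :
    Howe Γ (bisimDistance.dist M N) (C.fill M.1) (C.fill N.1) := by
  have h0 := bisimDistance.nonneg M N
  induction h with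
  | hole => exact .of_bisimDistance_le le_rfl
  | term hL => exact (Howe.refl hL).mono h0
  | lam _ ih => exact .lam ih
  | appL hd _ hL ih => simpa [Ctx.fill] using Howe.app hd ih (Howe.refl hL)
  | appR hd hL _ ih => simpa [Ctx.fill] using Howe.app hd (Howe.refl hL) ih
  | choice _ _ ih₁ ih₂ => exact .choice ih₁ ih₂

end AffineProb

theorem mainTheorem3 :
    IsGreatest (Function.fixedPoints (AffineProb.bisimOperator AffineProb.lambdaLMC))
      (AffineProb.bisimMetric AffineProb.lambdaLMC) ∧
    AffineProb.NonExpansive AffineProb.bisimDistance :=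
  ⟨OrderHom.isGreatest_gfp _, fun _ hC M N =>
    AffineProb.Howe.bisimDistance_le (hC.howe_fill M N)⟩
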